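/- Let $N\ge 2$ and let $X$ be the Walsh spider with $N$ legs, i.e. $N$ copies $I_1,\dots,I_N$ of $[0,\infty)$ glued at their origins, with the measure $\mu$ that is Lebesgue measure on each leg. Write a function on $X$ as $f=(f_j)_{j=1}^N$ with $f_j$ a function on $I_j$, so that $L^2(X)=\bigoplus_j L^2(I_j)$ (real-valued), and write $f'=(f_j')_j$. Let $$H^1_0(X)=\{f: f_j\in H^1(I_j)\ \forall j,\ f_1(0)=\dots=f_N(0)\},\qquad H^1_1(X)=\Big\{f: f_j\in H^1(I_j)\ \forall j,\ \sum_j f_j(0)=0\Big\}.$$ Let $\Delta f=f''$ with domain $\{f\in H^1_0(X): f'\in H^1_1(X)\}$ (Kirchhoff conditions); it is the generator of the Dirichlet form $\mathcal E(f,g)=\int f'g'\,d\mu$ with $\operatorname{Dom}\mathcal E=H^1_0(X)$, whose carré du champ is $\Gamma(f,g)=f'g'$, $\Gamma(f)=\Gamma(f,f)$. Let $\vec\Delta f=f''$ with domain $\{f\in H^1_1(X): f'\in H^1_0(X)\}$ (anti-Kirchhoff conditions); this is the Laplacian on one-forms, where one-forms are identified with functions through $\partial f\mapsto f'$. Let $g_t(u)=(4\pi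 t)^{-1/2}e^{-u^2/4t}$. Then $\Delta$ and $\vec\Delta$ each generate a unique strongly continuous semigroup, $e^{t\Delta}$ and $e^{t\vec\Delta}$, on $L^2(X)$, and the following hold. 1. For $t>0$ the operators $e^{t\Delta}$ and $e^{t\vec\Delta}$ have the integral kernels given, for $x\in I_j$ and $y\in I_k$, by $$p_t(x_j,y_k)=\begin{cases}\frac2N\,g_t(x+y)& j\ne k,\\ g_t(x-y)-\left(1-\frac2N\right)g_t(x+y)& j=k,\end{cases}\qquad \vec p_t(x_j,y_k)=\begin{cases}-\frac2N\,g_t(x+y)& j\ne k,\\ g_t(x-y)+\left(1-\frac2N\right)g_t(x+y)& j=k.\end{cases}$$ 2. $|\vec p_t(x_j,y_k)|\le (N-1)\,p_t(x_j,y_k)$ for all $t>0$, all legs $j,k$ and all $x,y\ge0$. 3. $|e^{t\vec\Delta}f|\le (N-1)\,e^{t\Delta}|f|$ almost everywhere, for all $t\ge0$ and $f\in L^2(X)$. 4. For all $t\ge0$ and $f\in\operatorname{Dom}\mathcal E=H^1_0(X)$ one has $e^{t\Delta}f\in\operatorname{Dom}\mathcal E$ and $$\sqrt{\Gamma(e^{t\Delta}f)}\le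 (N-1)\,e^{t\Delta}\sqrt{\Gamma(f)}\quad\text{almost everywhere.}$$ The constant $N-1$ is optimal in each of 2, 3 and 4: for every fixed $t>0$, if one of these inequalities (in 2, for all $x,y>0$ and all legs) holds for all its arguments with a constant $C\in\mathbb R$ in place of $N-1$, then $C\ge N-1$. -/

import Mathlib

open MeasureTheory Set Filter Topology
open scoped NNReal ENNReal ContDiff

noncomputable section

namespace WalshSpider

/-! The Walsh spider with `N` legs: `N` copies of `[0, ∞)`, glued at `0`, with Lebesgue measure on
each leg.  Functions on it are families `f = (f_j)` of functions on the legs, and gluing enters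
through the conditions imposed on the traces of the `f_j` at `0`. -/

/-- Lebesgue measure on one leg (as a measure on `ℝ`, carried by `(0, ∞)`). -/
abbrev legMeasure : Measure ℝ := volume.restrict (Ioi 0)

/-- The real Hilbert space `L²(0, ∞)`. -/
abbrev LegL2 : Type := Lp ℝ 2 legMeasure

/-- The Hilbert space `L²(X)` of the spider, the orthogonal sum of the spaces `L²` of the legs. -/
abbrev SpiderL2 (N : ℕ) : Type := PiLp 2 (fun _ : Fin N => LegL2)

/-- `g` is the weak derivative of `f` on the open half-line `(0, ∞)`. -/
def HasWeakDeriv (f g : LegL2) : Prop :=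
  ∀ φ : ℝ → ℝ, ContDiff ℝ ∞ φ → HasCompactSupport φ → tsupport φ ⊆ Ioi 0 →
    ∫ x in Ioi 0, f x * deriv φ x = - ∫ x in Ioi 0, g x * φ x

/-- `c` is the trace of `f` at the vertex: the value at `0` of a representative of `f` that is
continuous on `[0, ∞)`. -/
def HasTrace (f : LegL2) (c : ℝ) : Prop :=
  ∃ F : ℝ → ℝ, ContinuousOn F (Ici 0) ∧ F 0 = c ∧ f =ᵐ[legMeasure] F

open Classical in
/-- The weak derivative of `f`, when it exists in `L²(0, ∞)` (and `0` otherwise). -/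
def weakDeriv (f : LegL2) : LegL2 :=
  if h : ∃ g, HasWeakDeriv f g then h.choose else 0

lemma integrable_mul_test (f : LegL2) {φ : ℝ → ℝ} (hφ : Continuous φ)
    (hc : HasCompactSupport φ) : Integrable (fun x => f x * φ x) legMeasure :=
  (Lp.memLp f).integrable_mul ((hφ.memLp_of_hasCompactSupport hc (p := 2)).restrict _)

lemma HasWeakDeriv.unique {f g g' : LegL2} (h : HasWeakDeriv f g) (h' : HasWeakDeriv f g') :
    g = g' := by
  have hloc : LocallyIntegrableOn (fun x => g x - g' x) (Ioi 0) volume := by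
    have h1 : LocallyIntegrable (fun x => g x - g' x) legMeasure :=
      ((Lp.memLp g).sub (Lp.memLp g')).locallyIntegrable (by norm_num)
    exact locallyIntegrableOn_of_locallyIntegrable_restrict h1
  have h0 := isOpen_Ioi.ae_eq_zero_of_integral_contDiff_smul_eq_zero hloc (by
    intro φ hφ hc hs
    have e : ∀ x, φ x • (g x - g' x) = g x * φ x - g' x * φ x := by
      intro x; simp only [smul_eq_mul]; ring
    have hz : ∀ x, x ∉ Ioi (0 : ℝ) → φ x • (g x - g' x) = 0 := by
      intro x hx
      rw [image_eq_zero_of_notMem_tsupport (fun hh => hx (hs hh)), zero_smul]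
    rw [← setIntegral_eq_integral_of_forall_compl_eq_zero hz]
    simp only [e]
    rw [integral_sub (integrable_mul_test g hφ.continuous hc)
      (integrable_mul_test g' hφ.continuous hc)]
    have a := h φ hφ hc hs
    have b := h' φ hφ hc hs
    linarith)
  apply Lp.ext
  rw [EventuallyEq, ae_restrict_iff' measurableSet_Ioi]
  filter_upwards [h0] with x hx hx'
  have := hx hx'
  linarith

lemma HasWeakDeriv.weakDeriv_eq {f g : LegL2} (h : HasWeakDeriv f g) : weakDeriv f = g := by
  have hex : ∃ g, HasWeakDeriv f g := ⟨g, h⟩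
  rw [weakDeriv, dif_pos hex]
  exact hex.choose_spec.unique h

lemma hasWeakDeriv_zero : HasWeakDeriv 0 0 := by
  intro φ _ _ _
  have h : ∀ ψ : ℝ → ℝ, ∫ x in Ioi (0 : ℝ), (0 : LegL2) x * ψ x = 0 := by
    intro ψ
    apply integral_eq_zero_of_ae
    filter_upwards [Lp.coeFn_zero ℝ 2 legMeasure] with x hx
    rw [hx]; simp
  rw [h, h]; simp

lemma HasWeakDeriv.add {f g f' g' : LegL2} (h : HasWeakDeriv f g) (h' : HasWeakDeriv f' g') :
    HasWeakDeriv (f + f') (g + g') := by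
  intro φ hφ hc hs
  have key : ∀ (u v : LegL2) (ψ : ℝ → ℝ), Continuous ψ → HasCompactSupport ψ →
      ∫ x in Ioi (0 : ℝ), (u + v : LegL2) x * ψ x
        = (∫ x in Ioi (0 : ℝ), u x * ψ x) + ∫ x in Ioi (0 : ℝ), v x * ψ x := by
    intro u v ψ hψ hψc
    rw [← integral_add (integrable_mul_test u hψ hψc) (integrable_mul_test v hψ hψc)]
    apply integral_congr_ae
    filter_upwards [Lp.coeFn_add u v] with x hx
    rw [hx, Pi.add_apply]; ring
  rw [key f f' _ (hφ.continuous_deriv (by simp)) hc.deriv, key g g' _ hφ.continuous hc,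
    h φ hφ hc hs, h' φ hφ hc hs]
  ring

lemma HasWeakDeriv.smul {f g : LegL2} (a : ℝ) (h : HasWeakDeriv f g) :
    HasWeakDeriv (a • f) (a • g) := by
  intro φ hφ hc hs
  have key : ∀ (u : LegL2) (ψ : ℝ → ℝ),
      ∫ x in Ioi (0 : ℝ), (a • u : LegL2) x * ψ x = a * ∫ x in Ioi (0 : ℝ), u x * ψ x := by
    intro u ψ
    rw [← integral_const_mul]
    apply integral_congr_ae
    filter_upwards [Lp.coeFn_smul a u] with x hx
    rw [hx, Pi.smul_apply, smul_eq_mul]; ring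
  rw [key, key, h φ hφ hc hs]
  ring

lemma hasTrace_zero : HasTrace 0 0 :=
  ⟨0, continuousOn_const, rfl, Lp.coeFn_zero ℝ 2 legMeasure⟩

lemma HasTrace.add {f f' : LegL2} {c c' : ℝ} (h : HasTrace f c) (h' : HasTrace f' c') :
    HasTrace (f + f') (c + c') := by
  obtain ⟨F, hF, h0, he⟩ := h
  obtain ⟨F', hF', h0', he'⟩ := h'
  exact ⟨F + F', hF.add hF', by simp [h0, h0'], (Lp.coeFn_add f f').trans (he.add he')⟩

lemma HasTrace.smul {f : LegL2} {c : ℝ} (a : ℝ) (h : HasTrace f c) :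
    HasTrace (a • f) (a * c) := by
  obtain ⟨F, hF, h0, he⟩ := h
  exact ⟨a • F, hF.const_smul a, by simp [h0], (Lp.coeFn_smul a f).trans (he.const_smul a)⟩

variable (N : ℕ)

/-- Functions on the spider that are in the Sobolev space `H¹(0, ∞)` on every leg. -/
def H1 : Submodule ℝ (SpiderL2 N) where
  carrier := {f | ∀ j, ∃ g, HasWeakDeriv (f j) g}
  zero_mem' := fun _ => ⟨0, hasWeakDeriv_zero⟩
  add_mem' := fun hf hg j => by
    obtain ⟨u, hu⟩ := hf j
    obtain ⟨v, hv⟩ := hg j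
    exact ⟨u + v, hu.add hv⟩
  smul_mem' := fun a f hf j => by
    obtain ⟨u, hu⟩ := hf j
    exact ⟨a • u, hu.smul a⟩

/-- `H¹₀(X)`: the functions in `H¹` of every leg that are continuous at the vertex.  This is the
domain of the Dirichlet form `𝓔(f, g) = ∫ f' g' dμ`. -/
def H10 : Submodule ℝ (SpiderL2 N) where
  carrier := {f | f ∈ H1 N ∧ ∃ c : ℝ, ∀ j, HasTrace (f j) c}
  zero_mem' := ⟨(H1 N).zero_mem, 0, fun _ => hasTrace_zero⟩
  add_mem' := by
    rintro f g ⟨hf, c, hc⟩ ⟨hg, c', hc'⟩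
    exact ⟨(H1 N).add_mem hf hg, c + c', fun j => (hc j).add (hc' j)⟩
  smul_mem' := by
    rintro a f ⟨hf, c, hc⟩
    exact ⟨(H1 N).smul_mem a hf, a * c, fun j => (hc j).smul a⟩

/-- `H¹₁(X)`: the functions in `H¹` of every leg whose traces at the vertex have sum `0`. -/
def H11 : Submodule ℝ (SpiderL2 N) where
  carrier := {f | f ∈ H1 N ∧ ∃ c : Fin N → ℝ, (∀ j, HasTrace (f j) (c j)) ∧ ∑ j, c j = 0}
  zero_mem' := ⟨(H1 N).zero_mem, 0, fun _ => hasTrace_zero, by simp⟩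
  add_mem' := by
    rintro f g ⟨hf, c, hc, hs⟩ ⟨hg, c', hc', hs'⟩
    exact ⟨(H1 N).add_mem hf hg, c + c', fun j => (hc j).add (hc' j), by
      simp [Finset.sum_add_distrib, hs, hs']⟩
  smul_mem' := by
    rintro a f ⟨hf, c, hc, hs⟩
    exact ⟨(H1 N).smul_mem a hf, fun j => a * c j, fun j => (hc j).smul a, by
      rw [← Finset.mul_sum, hs, mul_zero]⟩

variable {N}

/-- The derivative `f' = (f_j')`, every leg being oriented away from the vertex. -/
def deriv' (f : SpiderL2 N) : SpiderL2 N := WithLp.toLp 2 (fun j => weakDeriv (f j))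

lemma deriv'_add {f g : SpiderL2 N} (hf : f ∈ H1 N) (hg : g ∈ H1 N) :
    deriv' (f + g) = deriv' f + deriv' g := by
  ext1 j
  obtain ⟨u, hu⟩ := hf j
  obtain ⟨v, hv⟩ := hg j
  have h : weakDeriv (f j + g j) = u + v := (hu.add hv).weakDeriv_eq
  simp [deriv', h, hu.weakDeriv_eq, hv.weakDeriv_eq]

lemma deriv'_smul (a : ℝ) {f : SpiderL2 N} (hf : f ∈ H1 N) :
    deriv' (a • f) = a • deriv' f := by
  ext1 j
  obtain ⟨u, hu⟩ := hf j
  have h : weakDeriv (a • f j) = a • u := (hu.smul a).weakDeriv_eq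
  simp [deriv', h, hu.weakDeriv_eq]

lemma deriv'_zero : deriv' (0 : SpiderL2 N) = 0 := by
  ext1 j
  have h : weakDeriv 0 = 0 := hasWeakDeriv_zero.weakDeriv_eq
  simp [deriv', h]

variable (N)

/-- The operator `f ↦ f''` with domain `{f ∈ V | f' ∈ W}`, for spaces `V, W` inside `H¹`. -/
def secondDeriv (V W : Submodule ℝ (SpiderL2 N)) (hV : V ≤ H1 N) (hW : W ≤ H1 N) :
    SpiderL2 N →ₗ.[ℝ] SpiderL2 N where
  domain :=
    { carrier := {f | f ∈ V ∧ deriv' f ∈ W}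
      zero_mem' := ⟨V.zero_mem, by rw [deriv'_zero]; exact W.zero_mem⟩
      add_mem' := by
        rintro f g ⟨hf, hf'⟩ ⟨hg, hg'⟩
        exact ⟨V.add_mem hf hg, by
          rw [deriv'_add (hV hf) (hV hg)]; exact W.add_mem hf' hg'⟩
      smul_mem' := by
        rintro a f ⟨hf, hf'⟩
        exact ⟨V.smul_mem a hf, by
          rw [deriv'_smul a (hV hf)]; exact W.smul_mem a hf'⟩ }
  toFun :=
    { toFun := fun f => deriv' (deriv' (f : SpiderL2 N))
      map_add' := by
        rintro ⟨f, hf, hf'⟩ ⟨g, hg, hg'⟩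
        simp only [Submodule.coe_add]
        rw [deriv'_add (hV hf) (hV hg), deriv'_add (hW hf') (hW hg')]
      map_smul' := by
        rintro a ⟨f, hf, hf'⟩
        simp only [Submodule.coe_smul, RingHom.id_apply]
        rw [deriv'_smul a (hV hf), deriv'_smul a (hW hf')] }

lemma H10_le : H10 N ≤ H1 N := fun _ h => h.1

lemma H11_le : H11 N ≤ H1 N := fun _ h => h.1

/-- The Laplacian `Δ f = f''` with Kirchhoff conditions at the vertex: `f` and `f'` are in `H¹` of
every leg, `f` is continuous at the vertex and `∑ f_j'(0) = 0`. -/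
def laplacian : SpiderL2 N →ₗ.[ℝ] SpiderL2 N :=
  secondDeriv N (H10 N) (H11 N) (H10_le N) (H11_le N)

/-- The Laplacian on one-forms, which are identified with functions by means of `∂f ↦ f'`:
`f ↦ f''` with anti-Kirchhoff conditions at the vertex: `f` and `f'` are in `H¹` of every leg,
`∑ f_j(0) = 0`, and `f'` is continuous at the vertex. -/
def formLaplacian : SpiderL2 N →ₗ.[ℝ] SpiderL2 N :=
  secondDeriv N (H11 N) (H10 N) (H11_le N) (H10_le N)

/-- `T` is the strongly continuous semigroup `(e^{tA})_{t ≥ 0}` of bounded operators whose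
infinitesimal generator is `A`, with its exact domain. -/
structure IsSemigroupOf {E : Type*} [NormedAddCommGroup E] [NormedSpace ℝ E]
    (A : E →ₗ.[ℝ] E) (T : ℝ≥0 → E →L[ℝ] E) : Prop where
  map_zero : T 0 = ContinuousLinearMap.id ℝ E
  map_add : ∀ s t, T (s + t) = (T s).comp (T t)
  continuous_apply : ∀ u, Continuous (fun t => T t u)
  generator : ∀ u v : E, (u, v) ∈ A.graph ↔
    Tendsto (fun h : ℝ≥0 => (h : ℝ)⁻¹ • (T h u - u)) (𝓝[>] 0) (𝓝 v)

/-- The Gaussian `g_t(u) = (4πt)^{-1/2} e^{-u²/4t}`. -/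
def gauss (t u : ℝ) : ℝ := Real.exp (-u ^ 2 / (4 * t)) / √(4 * Real.pi * t)

/-- The heat kernel `p_t(x_j, y_k)`, for `x` on leg `j` and `y` on leg `k`. -/
def heatKernel (t : ℝ) (j : Fin N) (x : ℝ) (k : Fin N) (y : ℝ) : ℝ :=
  if j = k then gauss t (x - y) - (1 - 2 / (N : ℝ)) * gauss t (x + y)
  else 2 / (N : ℝ) * gauss t (x + y)

/-- The heat kernel on one-forms, for `x` on leg `j` and `y` on leg `k`. -/
def formHeatKernel (t : ℝ) (j : Fin N) (x : ℝ) (k : Fin N) (y : ℝ) : ℝ :=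
  if j = k then gauss t (x - y) + (1 - 2 / (N : ℝ)) * gauss t (x + y)
  else -(2 / (N : ℝ) * gauss t (x + y))

variable {N}

/-- The operator `K` on `L²(X)` has integral kernel `k`. -/
def HasKernel (K : SpiderL2 N →L[ℝ] SpiderL2 N) (k : Fin N → ℝ → Fin N → ℝ → ℝ) : Prop :=
  ∀ (f : SpiderL2 N) (i : Fin N), ∀ᵐ x ∂legMeasure,
    (∀ j, Integrable (fun y => k i x j y * f j y) legMeasure) ∧
      K f i x = ∑ j, ∫ y in Ioi 0, k i x j y * f j y

/-- The pointwise absolute value `|f|` of a function in `L²(X)`. -/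
def absL2 (f : SpiderL2 N) : SpiderL2 N := WithLp.toLp 2 (fun j => |f j|)

/-- The pointwise (almost everywhere) order on `L²(X)`. -/
def LeAE (f g : SpiderL2 N) : Prop := ∀ j, ∀ᵐ x ∂legMeasure, f j x ≤ g j x

/-- The carré du champ `Γ(f, g) = f' g'`, for `f, g ∈ H¹₀(X)`. -/
def carre (f g : SpiderL2 N) (j : Fin N) (x : ℝ) : ℝ := deriv' f j x * deriv' g j x

lemma memLp_sqrt_carre (f : SpiderL2 N) (j : Fin N) :
    MemLp (fun x => √(carre f f j x)) 2 legMeasure := by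
  have h : (fun x => √(carre f f j x)) = fun x => ‖deriv' f j x‖ := by
    funext x
    rw [carre, Real.sqrt_mul_self_eq_abs, Real.norm_eq_abs]
  rw [h]
  exact (Lp.memLp (deriv' f j)).norm

/-- The function `√Γ(f) = √Γ(f, f)`, as an element of `L²(X)`. -/
def sqrtCarre (f : SpiderL2 N) : SpiderL2 N :=
  WithLp.toLp 2 (fun j => (memLp_sqrt_carre f j).toLp _)

end WalshSpider

end

/-! Split a function on the spider into its mean over the legs and the deviations from it, which sum
to zero. The Kirchhoff conditions decouple: continuity at the vertex says that the deviations vanish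
at `0`, and the flux condition says that the mean has derivative `0` there. So `Δ` is the Neumann
Laplacian on the mean and the Dirichlet Laplacian on each deviation; the anti-Kirchhoff conditions
exchange the two roles. A sign `ε` (`1` for Kirchhoff or Neumann, `-1` for anti-Kirchhoff or
Dirichlet) treats both cases at once.

The half-line problems are solved by even or odd reflection to the line, where the heat semigroup is
the average of the translation group under a Gaussian law of variance `2t`. This yields contraction
semigroups with kernels `g_t(x-y) ± g_t(x+y)`; gluing mean and deviations (`spiderHeat`) gives the
kernels of the theorem (`hasKernel_spiderHeat`).

To identify generators with their exact domains it suffices that the Laplacian is contained in the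
generator of the contraction semigroup and that `1 - Δ` is onto
(`IsContractionSemigroup.isSemigroupOf`). Surjectivity comes from Laplace transforms of the
translation group. The same two facts make the semigroup unique, even among semigroups not assumed
contractive (`IsContractionSemigroup.unique`).

Differentiation commutes with translations and exchanges even and odd functions, hence `(e^{tΔ} f)'
= e^{t\vec Δ} f'` (`deriv'_spiderHeat`). As `√Γ(f) = |f'|`, the gradient estimate is the domination
of semigroups applied to `f'`, and that domination is the kernel bound integrated. The kernel bound
follows from `g_t(x+y) ≤ g_t(x-y)`.

At the vertex, on one leg, the kernels are `(2/N) g_t(0)` and `(2 - 2/N) g_t(0)`, with ratio `N -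
1`, so the constant is optimal. Indicators of short intervals at the vertex carry this from kernels
to operators, and density of the derivatives of `H¹₀(X)` in `L²(X)` carries it to the gradient
estimate. -/

noncomputable section

namespace WalshSpider

/-! ### Contraction semigroups: identification of the generator and uniqueness -/

section Semigroup

variable {E : Type*} [NormedAddCommGroup E] [InnerProductSpace ℝ E]

/-- A strongly continuous semigroup of contractions. -/
structure IsContractionSemigroup (T : ℝ≥0 → E →L[ℝ] E) : Prop where
  map_zero : T 0 = ContinuousLinearMap.id ℝ E
  map_add : ∀ s t, T (s + t) = (T s).comp (T t)
  continuous_apply : ∀ u, Continuous (fun t => T t u)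
  norm_le : ∀ t u, ‖T t u‖ ≤ ‖u‖

/-- `(u, v)` is in the graph of the infinitesimal generator of `T`. -/
def HasGenerator (T : ℝ≥0 → E →L[ℝ] E) (u v : E) : Prop :=
  Tendsto (fun h : ℝ≥0 => (h : ℝ)⁻¹ • (T h u - u)) (𝓝[>] 0) (𝓝 v)

lemma HasGenerator.sub {T : ℝ≥0 → E →L[ℝ] E} {u v u' v' : E} (h : HasGenerator T u v)
    (h' : HasGenerator T u' v') : HasGenerator T (u - u') (v - v') := by
  refine (Tendsto.sub h h').congr fun r => ?_
  rw [← smul_sub, map_sub]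
  congr 1
  abel

/-- Dissipativity: contractivity and Cauchy–Schwarz give `⟨T_r u, u⟩ ≤ ‖u‖²`, so every difference
quotient pairs non-positively with `u`. -/
lemma HasGenerator.inner_nonpos {T : ℝ≥0 → E →L[ℝ] E} (hT : ∀ t u, ‖T t u‖ ≤ ‖u‖) {u v : E}
    (h : HasGenerator T u v) : inner ℝ v u ≤ 0 := by
  have h1 : Tendsto (fun r : ℝ≥0 => inner ℝ ((r : ℝ)⁻¹ • (T r u - u)) u) (𝓝[>] 0)
      (𝓝 (inner ℝ v u)) := Tendsto.inner h tendsto_const_nhds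
  refine le_of_tendsto h1 (Eventually.of_forall fun r => ?_)
  rw [real_inner_smul_left, inner_sub_left]
  refine mul_nonpos_of_nonneg_of_nonpos (by positivity) ?_
  have h2 := real_inner_le_norm (T r u) u
  have h3 := mul_le_mul_of_nonneg_right (hT r u) (norm_nonneg u)
  rw [real_inner_self_eq_norm_mul_norm]
  linarith

/-- Injectivity of `1 - G` for the generator `G`: this is why no extension of an operator with `1 -
A` onto can be proper. -/
lemma HasGenerator.eq_zero_of_self {T : ℝ≥0 → E →L[ℝ] E} (hT : ∀ t u, ‖T t u‖ ≤ ‖u‖) {u : E}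
    (h : HasGenerator T u u) : u = 0 :=
  real_inner_self_nonpos.1 (h.inner_nonpos hT)

/-- An operator with `1 - A` surjective that is contained in the generator of a contraction
semigroup is equal to the generator. -/
lemma IsContractionSemigroup.isSemigroupOf {T : ℝ≥0 → E →L[ℝ] E} (hT : IsContractionSemigroup T)
    {A : E →ₗ.[ℝ] E} (hA : ∀ u v, (u, v) ∈ A.graph → HasGenerator T u v)
    (hsurj : ∀ f, ∃ u v, (u, v) ∈ A.graph ∧ u - v = f) : IsSemigroupOf A T where
  map_zero := hT.map_zero
  map_add := hT.map_add
  continuous_apply := hT.continuous_apply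
  generator u v := by
    refine ⟨hA u v, fun h => ?_⟩
    -- The pair `(w, z)` in the graph of `A` has the same image `u - v` under `1 - A`; the
    -- difference of the two pairs is then an eigenvector of the generator with eigenvalue `1`,
    -- hence zero.
    obtain ⟨w, z, hwz, hf⟩ := hsurj (u - v)
    have h1 : HasGenerator T (u - w) (v - z) := HasGenerator.sub h (hA w z hwz)
    have h2 : v - z = u - w := by
      rw [sub_eq_sub_iff_add_eq_add] at hf ⊢
      rw [add_comm v w, hf]
    rw [h2] at h1
    have h3 := h1.eq_zero_of_self hT.norm_le
    rw [h3, sub_eq_zero] at h2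
    rw [sub_eq_zero.1 h3, h2]
    exact hwz

/-- The semigroup maps the domain of its generator to itself. -/
lemma IsSemigroupOf.hasGenerator_apply {A : E →ₗ.[ℝ] E} {T : ℝ≥0 → E →L[ℝ] E}
    (hT : IsSemigroupOf A T) {u v : E} (h : HasGenerator T u v) (s : ℝ≥0) :
    HasGenerator T (T s u) (T s v) := by
  refine (((T s).continuous.tendsto v).comp h).congr fun r => ?_
  have h1 : T r (T s u) = T s (T r u) := by
    have a := DFunLike.congr_fun (hT.map_add r s) u
    have b := DFunLike.congr_fun (hT.map_add s r) u
    rw [add_comm] at a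
    exact a.symm.trans b
  simp [h1]

/-- Two semigroups with the same generator agree on the domain of the generator, if one of them is
a contraction semigroup. -/
lemma IsSemigroupOf.apply_eq {A : E →ₗ.[ℝ] E} {S T : ℝ≥0 → E →L[ℝ] E}
    (hS : IsSemigroupOf A S) (hT : IsSemigroupOf A T) (hn : ∀ t u, ‖T t u‖ ≤ ‖u‖)
    {u v : E} (h : (u, v) ∈ A.graph) (t : ℝ≥0) : S t u = T t u := by
  -- The curve `s ↦ T(t-s) S(s) u` joins `T t u` to `S t u`, so it is enough that its right
  -- derivative vanishes on `[0, t)`. Truncation to `ℝ≥0` extends it continuously by constants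
  -- outside `[0, t]`.
  set φ : ℝ → E := fun s => T (t - s.toNNReal) (S s.toNNReal u) with hφ
  have hc1 : Continuous φ := by
    rw [continuous_iff_continuousAt]
    intro s
    have e1 : Tendsto (fun r : ℝ => S r.toNNReal u) (𝓝 s) (𝓝 (S s.toNNReal u)) :=
      ((hS.continuous_apply u).comp continuous_real_toNNReal).tendsto s
    have e2 : Tendsto (fun r : ℝ => T (t - r.toNNReal) (S s.toNNReal u)) (𝓝 s) (𝓝 (φ s)) :=
      ((hT.continuous_apply (S s.toNNReal u)).comp
        (continuous_const.sub continuous_real_toNNReal)).tendsto s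
    -- Both factors move with `r`. Contractivity of `T` controls the change of the vector uniformly
    -- in the time of `T`.
    have e3 : Tendsto (fun r : ℝ => T (t - r.toNNReal) (S r.toNNReal u - S s.toNNReal u)) (𝓝 s)
        (𝓝 0) := by
      refine squeeze_zero_norm (fun r => hn _ _) ?_
      simpa using (e1.sub_const (S s.toNNReal u)).norm
    have e4 := e3.add e2
    rw [zero_add] at e4
    refine e4.congr fun r => ?_
    simp [hφ]
  have hd : ∀ s ∈ Ico (0 : ℝ) t, HasDerivWithinAt φ 0 (Ici s) s := by
    intro s hs
    rw [hasDerivWithinAt_iff_tendsto_slope, Set.Ici_sdiff_left]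
    set w := S s.toNNReal u with hw
    have hgS : HasGenerator S w (S s.toNNReal v) :=
      hS.hasGenerator_apply ((hS.generator u v).1 h) _
    have hgT : HasGenerator T w (S s.toNNReal v) :=
      (hT.generator _ _).1 ((hS.generator _ _).2 hgS)
    -- The slope of `φ` from `s` to `s + r` is `T(t-s-r)` applied to the difference of the quotients
    -- of `S` and `T` at `w = S(s) u`. Both quotients tend to the same vector, and `T` does not
    -- increase the norm.
    have hdiff := Tendsto.sub hgS hgT
    rw [sub_self] at hdiff
    have hm : Tendsto (fun y : ℝ => (y - s).toNNReal) (𝓝[>] s) (𝓝[>] 0) := by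
      refine tendsto_nhdsWithin_iff.2 ⟨?_, ?_⟩
      · have : Continuous fun y : ℝ => (y - s).toNNReal := by fun_prop
        have h0 := this.tendsto s
        rw [sub_self, Real.toNNReal_zero] at h0
        exact h0.mono_left nhdsWithin_le_nhds
      · filter_upwards [self_mem_nhdsWithin] with y hy
        simpa using hy
    refine squeeze_zero_norm' ?_ (by
      simpa only [norm_zero, Function.comp_def] using (hdiff.comp hm).norm)
    have hlt : ∀ᶠ y : ℝ in 𝓝[>] s, y < t := nhdsWithin_le_nhds (eventually_lt_nhds hs.2)
    filter_upwards [self_mem_nhdsWithin, hlt] with y hy hyt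
    have hy' : s < y := hy
    set r : ℝ≥0 := (y - s).toNNReal with hr
    have hr' : (r : ℝ) = y - s := Real.coe_toNNReal _ (by linarith)
    have e1 : y.toNNReal = r + s.toNNReal := by
      rw [hr, ← Real.toNNReal_add (by linarith) hs.1, sub_add_cancel]
    have hle : y.toNNReal ≤ t := Real.toNNReal_le_iff_le_coe.2 hyt.le
    have e2 : t - s.toNNReal = (t - y.toNNReal) + r := by
      rw [e1] at hle ⊢
      rw [tsub_add_eq_add_tsub hle, add_comm r, add_tsub_add_eq_tsub_right]
    have e3 : φ y - φ s = T (t - y.toNNReal) (S r w - T r w) := by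
      have e5 : S y.toNNReal u = S r w := by rw [e1, hS.map_add]; rfl
      have e6 : T (t - s.toNNReal) w = T (t - y.toNNReal) (T r w) := by
        rw [e2, hT.map_add]; rfl
      rw [map_sub, ← e5, ← e6]
    have e4 : ((r : ℝ)⁻¹ • (S r w - w) - (r : ℝ)⁻¹ • (T r w - w))
        = (r : ℝ)⁻¹ • (S r w - T r w) := by
      rw [← smul_sub]; congr 1; abel
    rw [slope_def_module, e3, ← hr', e4, norm_smul, norm_smul]
    exact mul_le_mul_of_nonneg_left (hn _ _) (norm_nonneg _)
  have key := constant_of_has_deriv_right_zero hc1.continuousOn hd t ⟨t.2, le_rfl⟩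
  simpa [hφ, hS.map_zero, hT.map_zero] using key

variable [CompleteSpace E]

/-- If `A` is contained in the generator of a contraction semigroup `T` and `1 - A` is surjective,
then `T` is the only semigroup with generator `A`. -/
lemma IsContractionSemigroup.unique {T : ℝ≥0 → E →L[ℝ] E} (hT : IsContractionSemigroup T)
    {A : E →ₗ.[ℝ] E} (hA : ∀ u v, (u, v) ∈ A.graph → HasGenerator T u v)
    (hsurj : ∀ f, ∃ u v, (u, v) ∈ A.graph ∧ u - v = f) {S : ℝ≥0 → E →L[ℝ] E}
    (hS : IsSemigroupOf A S) : S = T := by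
  -- Density of the domain: write `z` orthogonal to it as `u - v` with `(u, v)` in the graph. Then
  -- `‖u‖² = ⟨v, u⟩ ≤ 0`, so `u = 0`, and `v`, being the value of the generator at `0`, is zero as
  -- well.
  have hd : A.domain.topologicalClosure = ⊤ := by
    rw [Submodule.topologicalClosure_eq_top_iff, Submodule.eq_bot_iff]
    intro z hz
    obtain ⟨u, v, huv, rfl⟩ := hsurj z
    have hu : u ∈ A.domain := by
      obtain ⟨y, rfl, -⟩ := (LinearPMap.mem_graph_iff A).1 huv
      exact y.2
    have h1 : inner ℝ (u - v) u = 0 := Submodule.inner_left_of_mem_orthogonal hu hz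
    have h2 := (hA u v huv).inner_nonpos hT.norm_le
    rw [inner_sub_left] at h1
    have h3 : u = 0 := real_inner_self_nonpos.1 (by linarith)
    have h4 := hA u v huv
    subst h3
    have h5 : HasGenerator T 0 0 := by simp [HasGenerator]
    rw [tendsto_nhds_unique h4 h5, sub_zero]
  have hdense : Dense (A.domain : Set E) := Submodule.dense_iff_topologicalClosure_eq_top.2 hd
  funext t
  refine DFunLike.coe_injective
    (Continuous.ext_on hdense (S t).continuous (T t).continuous fun u hu => ?_)
  exact hS.apply_eq (hT.isSemigroupOf hA hsurj) hT.norm_le (A.mem_graph ⟨u, hu⟩) t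

end Semigroup

/-! ### Groups of isometries and the heat semigroup generated by the square of their generator -/

section IsometryGroup

open ProbabilityTheory

variable {E : Type*} [NormedAddCommGroup E] [InnerProductSpace ℝ E]

/-- A strongly continuous one-parameter group of isometries. -/
structure IsIsometryGroup (U : ℝ → E →L[ℝ] E) : Prop where
  map_zero : U 0 = ContinuousLinearMap.id ℝ E
  map_add : ∀ s t u, U (s + t) u = U s (U t u)
  continuous_apply : ∀ u, Continuous (fun t => U t u)
  norm_map : ∀ t u, ‖U t u‖ = ‖u‖

/-- `b` is the derivative of `a` along the group `U`. -/
def HasGroupDeriv (U : ℝ → E →L[ℝ] E) (a b : E) : Prop :=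
  HasDerivAt (fun s => U s a) b 0

namespace IsIsometryGroup

variable {U : ℝ → E →L[ℝ] E} (hU : IsIsometryGroup U)

include hU

lemma apply_zero (u : E) : U 0 u = u := by simp [hU.map_zero]

lemma inner_map (s : ℝ) (u v : E) : inner ℝ (U s u) v = inner ℝ u (U (-s) v) := by
  have h := (LinearIsometry.mk (U s : E →ₗ[ℝ] E) (hU.norm_map s)).inner_map_map u (U (-s) v)
  rw [← h]
  simp [← hU.map_add, hU.apply_zero]

lemma hasDerivAt {a b : E} (h : HasGroupDeriv U a b) (s : ℝ) :
    HasDerivAt (fun s => U s a) (U s b) s := by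
  have h0 : HasDerivAt (fun r => U r a) b (s - s) := by rwa [sub_self]
  have h1 := h0.comp_sub_const s s
  have h2 := (U s).hasFDerivAt.comp_hasDerivAt s h1
  refine h2.congr_of_eventuallyEq (Eventually.of_forall fun r => ?_)
  simp [← hU.map_add]

omit hU in
lemma hasGroupDeriv_neg {a b : E} (h : HasGroupDeriv U a b) :
    HasGroupDeriv (fun s => U (-s)) a (-b) := by
  have h0 : HasDerivAt (fun r => U r a) b (-0) := by rwa [neg_zero]
  have h1 := h0.scomp (0 : ℝ) (hasDerivAt_neg (0 : ℝ))
  rwa [neg_one_smul] at h1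

lemma neg : IsIsometryGroup (fun s => U (-s)) where
  map_zero := by simp [hU.map_zero]
  map_add s t u := by rw [neg_add, hU.map_add]
  continuous_apply u := (hU.continuous_apply u).comp continuous_neg
  norm_map t u := hU.norm_map _ u

/-- The generator is antisymmetric because the adjoint of `U s` is `U (-s)`. For translations this
is integration by parts, the source of weak derivatives below. -/
lemma inner_hasGroupDeriv {a b p q : E} (h : HasGroupDeriv U a b) (h' : HasGroupDeriv U p q) :
    inner ℝ b p = - inner ℝ a q := by
  have h1 : HasDerivAt (fun s => inner ℝ (U s a) p) (inner ℝ b p) 0 := by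
    simpa using h.inner ℝ (hasDerivAt_const (0 : ℝ) p)
  have h2 : HasDerivAt (fun s => inner ℝ (U s a) p) (inner ℝ a (-q)) 0 := by
    have := (hasDerivAt_const (0 : ℝ) a).inner ℝ (hasGroupDeriv_neg h')
    simp only [inner_zero_left, add_zero] at this
    exact this.congr_of_eventuallyEq (Eventually.of_forall fun s => hU.inner_map s a p)
  rw [h1.unique h2, inner_neg_right]

lemma integrable_apply (ν : Measure ℝ) [IsFiniteMeasure ν] (u : E) :
    Integrable (fun s => U s u) ν :=
  Integrable.of_bound (hU.continuous_apply u).aestronglyMeasurable ‖u‖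
    (Eventually.of_forall fun s => (hU.norm_map s u).le)

/-- The average of the group `U` with respect to a probability measure. -/
def average (ν : Measure ℝ) [IsProbabilityMeasure ν] : E →L[ℝ] E :=
  LinearMap.mkContinuous
    { toFun := fun u => ∫ s, U s u ∂ν
      map_add' := fun u v =>
        (integral_congr_ae (Eventually.of_forall fun s => (U s).map_add u v)).trans
          (integral_add (hU.integrable_apply ν u) (hU.integrable_apply ν v))
      map_smul' := fun a u =>
        (integral_congr_ae (Eventually.of_forall fun s => (U s).map_smul a u)).trans
          (integral_smul a _) } 1 (fun u => by
    simpa using norm_integral_le_of_norm_le_const (μ := ν) (f := fun s => U s u)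
      (Eventually.of_forall fun s => (hU.norm_map s u).le))

lemma average_apply (ν : Measure ℝ) [IsProbabilityMeasure ν] (u : E) :
    hU.average ν u = ∫ s, U s u ∂ν := rfl

lemma norm_average_le (ν : Measure ℝ) [IsProbabilityMeasure ν] (u : E) :
    ‖hU.average ν u‖ ≤ ‖u‖ := by
  simpa [average_apply] using norm_integral_le_of_norm_le_const (μ := ν) (f := fun s => U s u)
    (Eventually.of_forall fun s => (hU.norm_map s u).le)

variable [CompleteSpace E]

lemma integral_eq_sub {a b : E} (h : HasGroupDeriv U a b) (s : ℝ) :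
    ∫ r in 0..s, U r b = U s a - a := by
  rw [intervalIntegral.integral_eq_sub_of_hasDerivAt (fun r _ => hU.hasDerivAt h r)
    ((hU.continuous_apply b).intervalIntegrable _ _), hU.apply_zero]

lemma hasGroupDeriv_of_integral {a b : E} (h : ∀ s, U s a - a = ∫ r in 0..s, U r b) :
    HasGroupDeriv U a b := by
  have h1 : HasDerivAt (fun s => ∫ r in 0..s, U r b) (U 0 b) 0 :=
    intervalIntegral.integral_hasDerivAt_right (by simp)
      ((hU.continuous_apply b).stronglyMeasurableAtFilter _ _) (hU.continuous_apply b).continuousAt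
  rw [hU.apply_zero] at h1
  refine (h1.const_add a).congr_of_eventuallyEq (Eventually.of_forall fun s => ?_)
  simp [← h]

/-- Taylor's formula for the orbits of `U`, from a bound of first order for the derivative. -/
lemma norm_taylor_le {a b : E} (hab : HasGroupDeriv U a b) (c : E) {s K : ℝ}
    (h : ∀ r, |r| ≤ |s| → ‖U r b - b - r • c‖ ≤ K * |s|) :
    ‖U s a - a - s • b - (s ^ 2 / 2) • c‖ ≤ K * s ^ 2 := by
  have h2 : U s a - a - s • b - (s ^ 2 / 2) • c = ∫ r in 0..s, (U r b - b - r • c) := by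
    have i1 := (hU.continuous_apply b).intervalIntegrable (μ := volume) 0 s
    have i2 : IntervalIntegrable (fun r : ℝ => r • c) volume 0 s :=
      Continuous.intervalIntegrable (by fun_prop) _ _
    rw [intervalIntegral.integral_sub (i1.sub (by simp)) i2,
      intervalIntegral.integral_sub i1 (by simp), hU.integral_eq_sub hab,
      intervalIntegral.integral_smul_const, integral_id]
    simp
  rw [h2]
  have h3 := intervalIntegral.norm_integral_le_of_norm_le_const (a := 0) (b := s)
    (f := fun r => U r b - b - r • c) (C := K * |s|) (fun r hr => h r (by
        rw [mem_uIoc] at hr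
        rcases hr with hr | hr
        · rw [abs_of_pos hr.1, abs_of_pos (hr.1.trans_le hr.2)]; exact hr.2
        · rw [abs_of_nonpos hr.2, abs_of_nonpos (hr.1.le.trans hr.2)]; linarith [hr.1]))
  refine h3.trans_eq ?_
  rw [sub_zero, mul_assoc, abs_mul_abs_self, sq]

/-- A quadratic bound valid for all `s`, which serves as the dominating function in
`hasGenerator_heat`. -/
lemma norm_sub_sub_le {a b c : E} (hab : HasGroupDeriv U a b) (hbc : HasGroupDeriv U b c)
    (s : ℝ) : ‖U s a - a - s • b‖ ≤ ‖c‖ * s ^ 2 := by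
  simpa using hU.norm_taylor_le hab 0 (s := s) (K := ‖c‖) fun r hr => by
    rw [smul_zero, sub_zero, ← hU.integral_eq_sub hbc]
    refine (intervalIntegral.norm_integral_le_of_norm_le_const (a := 0) (b := r)
      (f := fun r => U r c) (C := ‖c‖) (fun x _ => (hU.norm_map x c).le)).trans ?_
    rw [sub_zero]
    exact mul_le_mul_of_nonneg_left hr (norm_nonneg c)

lemma isLittleO_taylor {a b c : E} (hab : HasGroupDeriv U a b) (hbc : HasGroupDeriv U b c) :
    (fun s : ℝ => U s a - a - s • b - (s ^ 2 / 2) • c) =o[𝓝 0] fun s => s ^ 2 := by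
  rw [Asymptotics.isLittleO_iff]
  intro ε hε
  have h1 := hasDerivAt_iff_isLittleO_nhds_zero.1 hbc
  rw [Asymptotics.isLittleO_iff] at h1
  obtain ⟨δ, hδ, h2⟩ := Metric.eventually_nhds_iff.1 (h1 hε)
  refine Metric.eventually_nhds_iff.2 ⟨δ, hδ, fun s hs => ?_⟩
  have h3 := hU.norm_taylor_le hab c (s := s) (K := ε) fun r hr => by
    have h4 : dist r 0 < δ := by
      rw [Real.dist_0_eq_abs] at hs ⊢
      exact hr.trans_lt hs
    have h5 := h2 h4
    simp only [zero_add, hU.apply_zero, Real.norm_eq_abs] at h5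
    exact h5.trans (mul_le_mul_of_nonneg_left hr hε.le)
  simpa using h3

lemma average_comm (ν : Measure ℝ) [IsProbabilityMeasure ν] (s : ℝ) (u : E) :
    hU.average ν (U s u) = U s (hU.average ν u) := by
  rw [average_apply, average_apply, ← (U s).integral_comp_comm (hU.integrable_apply ν u)]
  simp only [← hU.map_add, add_comm]

/-- A bounded operator commuting with `U` preserves its differentiable vectors and commutes with the
derivative. -/
lemma hasGroupDeriv_average (ν : Measure ℝ) [IsProbabilityMeasure ν] {a b : E}
    (h : HasGroupDeriv U a b) : HasGroupDeriv U (hU.average ν a) (hU.average ν b) := by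
  have := (hU.average ν).hasFDerivAt.comp_hasDerivAt (0 : ℝ) h
  refine this.congr_of_eventuallyEq (Eventually.of_forall fun s => ?_)
  simp [hU.average_comm]

/-- The heat semigroup generated by the square of the generator of `U`: the average of `U` with
respect to the Gaussian law of variance `2 t`. -/
def heat (t : ℝ≥0) : E →L[ℝ] E := hU.average (gaussianReal 0 (2 * t))

lemma heat_zero : hU.heat 0 = ContinuousLinearMap.id ℝ E := by
  ext u
  rw [heat, average_apply]
  simp [gaussianReal_zero_var, hU.apply_zero]

lemma heat_add (s t : ℝ≥0) : hU.heat (s + t) = (hU.heat s).comp (hU.heat t) := by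
  ext u
  simp only [heat, ContinuousLinearMap.comp_apply, average_apply]
  have h : gaussianReal 0 (2 * (s + t)) =
      (gaussianReal 0 (2 * s)) ∗ (gaussianReal 0 (2 * t)) := by
    rw [gaussianReal_conv_gaussianReal, mul_add, add_zero]
  rw [h, integral_conv (hU.integrable_apply _ u)]
  refine integral_congr_ae (Eventually.of_forall fun r => ?_)
  simp only [hU.map_add]
  exact (U r).integral_comp_comm (hU.integrable_apply _ u)

-- Rescaling to the standard Gaussian makes the measure independent of `t`, so that limits in `t`
-- are instances of dominated convergence.
omit [CompleteSpace E] in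
lemma heat_apply (t : ℝ≥0) (u : E) :
    hU.heat t u = ∫ r, U (√(2 * t) * r) u ∂gaussianReal 0 1 := by
  have h : gaussianReal 0 (2 * t) = (gaussianReal 0 1).map (√(2 * t) * ·) := by
    rw [gaussianReal_map_const_mul]
    congr 1
    · simp
    · ext
      simp only [NNReal.coe_mul, NNReal.coe_mk]
      rw [Real.sq_sqrt (by positivity)]; simp
  rw [heat, average_apply]
  simp_rw [h]
  rw [integral_map (by fun_prop) (hU.continuous_apply u).aestronglyMeasurable]

omit [CompleteSpace E] in
lemma continuous_heat (u : E) : Continuous (fun t => hU.heat t u) := by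
  simp only [hU.heat_apply]
  refine continuous_of_dominated (bound := fun _ => ‖u‖) (fun t => ?_) (fun t => ?_)
    (integrable_const _) (Eventually.of_forall fun r => ?_)
  · exact ((hU.continuous_apply u).comp (by fun_prop)).aestronglyMeasurable
  · exact Eventually.of_forall fun s => (hU.norm_map _ u).le
  · exact (hU.continuous_apply u).comp (by fun_prop)

lemma isContractionSemigroup_heat : IsContractionSemigroup hU.heat where
  map_zero := hU.heat_zero
  map_add := hU.heat_add
  continuous_apply := hU.continuous_heat
  norm_le _ u := hU.norm_average_le _ u

/-- The square of the generator of `U` is contained in the generator of the heat semigroup. -/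
lemma hasGenerator_heat {a b c : E} (hab : HasGroupDeriv U a b) (hbc : HasGroupDeriv U b c) :
    HasGenerator hU.heat a c := by
  set γ := gaussianReal 0 1 with hγ
  have hi2 : Integrable (fun r : ℝ => r ^ 2) γ :=
    (memLp_id_gaussianReal (μ := 0) (v := 1) 2).integrable_sq
  have hi1 : Integrable (fun r : ℝ => r) γ :=
    (memLp_id_gaussianReal (μ := 0) (v := 1) 1).integrable le_rfl
  have hc : ∫ r, r ^ 2 • c ∂γ = c := by
    have h1 : ∫ r, r ^ 2 ∂γ = 1 := by
      have h2 := variance_id_gaussianReal (μ := 0) (v := 1)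
      rw [variance_of_integral_eq_zero aemeasurable_id (by simp [integral_id_gaussianReal])] at h2
      simpa using h2
    rw [integral_smul_const, h1, one_smul]
  -- The first-order term may be subtracted for free because the Gaussian is centred; without it the
  -- integrand would be of order `h^{-1/2}`.
  have he : ∀ h : ℝ≥0, (h : ℝ)⁻¹ • (hU.heat h a - a) =
      ∫ r, (h : ℝ)⁻¹ • (U (√(2 * h) * r) a - a - (√(2 * h) * r) • b) ∂γ := by
    intro h
    have i1 : Integrable (fun r => U (√(2 * h) * r) a) γ :=
      Integrable.of_bound ((hU.continuous_apply a).comp (by fun_prop)).aestronglyMeasurable ‖a‖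
        (Eventually.of_forall fun s => (hU.norm_map _ a).le)
    have i2 : Integrable (fun r => (√(2 * h) * r) • b) γ := (hi1.const_mul _).smul_const b
    have i3 : ∫ r, (√(2 * h) * r) • b ∂γ = 0 := by
      rw [integral_smul_const, integral_const_mul, integral_id_gaussianReal, mul_zero, zero_smul]
    have i4 : ∫ r, (U (√(2 * h) * r) a - a) ∂γ = hU.heat h a - a := by
      rw [integral_sub i1 (integrable_const a), hU.heat_apply, integral_const]
      simp only [probReal_univ, one_smul, hγ]
    have i5 : Integrable (fun r => U (√(2 * h) * r) a - a) γ := i1.sub (integrable_const a)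
    rw [integral_smul, integral_sub i5 i2, i3, i4, sub_zero]
  rw [HasGenerator, funext he, ← hc]
  -- With `s = √(2h) r` one has `s² = 2 h r²`: the bound `‖c‖ s²` divided by `h` is the dominating
  -- function, and the Taylor term `(s²/2) c` divided by `h` is `r² c`, whose Gaussian mean is `c`.
  refine tendsto_integral_filter_of_dominated_convergence (fun r => 2 * ‖c‖ * r ^ 2) ?_ ?_
    (hi2.const_mul _) ?_
  · refine Eventually.of_forall fun h => ?_
    refine Continuous.aestronglyMeasurable ?_
    have := (hU.continuous_apply a).comp
      (continuous_const.mul continuous_id : Continuous fun r => √(2 * h) * r)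
    exact ((this.sub continuous_const).sub (by fun_prop)).const_smul _
  · filter_upwards [self_mem_nhdsWithin] with h hh
    refine Eventually.of_forall fun r => ?_
    have hh' : 0 < (h : ℝ) := hh
    have h1 := hU.norm_sub_sub_le hab hbc (√(2 * h) * r)
    rw [mul_pow, Real.sq_sqrt (by positivity)] at h1
    rw [norm_smul, norm_inv, Real.norm_of_nonneg hh'.le, inv_mul_le_iff₀ hh']
    linarith
  · refine Eventually.of_forall fun r => ?_
    have ht : Tendsto (fun h : ℝ≥0 => √(2 * h) * r) (𝓝[>] 0) (𝓝 0) := by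
      have : Continuous fun h : ℝ≥0 => √(2 * h) * r := by fun_prop
      simpa using (this.tendsto 0).mono_left nhdsWithin_le_nhds
    have h1 := (hU.isLittleO_taylor hab hbc).comp_tendsto ht
    have h2 : (fun s : ℝ => s ^ 2) ∘ (fun h : ℝ≥0 => √(2 * h) * r) =
        fun h : ℝ≥0 => (2 * r ^ 2) * (h : ℝ) := by
      funext h
      simp only [Function.comp_apply]
      rw [mul_pow, Real.sq_sqrt (by positivity)]
      ring
    rw [h2] at h1
    have h3 :=
      (h1.trans_isBigO (Asymptotics.isBigO_const_mul_self _ _ _)).tendsto_inv_smul_nhds_zero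
    have h4 := h3.add_const (r ^ 2 • c)
    rw [zero_add] at h4
    refine h4.congr' ?_
    filter_upwards [self_mem_nhdsWithin] with h hh
    have hh' : 0 < (h : ℝ) := hh
    simp only [Function.comp_apply]
    rw [smul_sub _ _ ((_ : ℝ) • c), smul_smul, mul_pow, Real.sq_sqrt (by positivity)]
    have : (h : ℝ)⁻¹ * (2 * h * r ^ 2 / 2) = r ^ 2 := by field_simp
    rw [this, sub_add_cancel]

omit hU [CompleteSpace E] in
lemma _root_.WalshSpider.HasGroupDeriv.add {a b a' b' : E} (h : HasGroupDeriv U a b)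
    (h' : HasGroupDeriv U a' b') : HasGroupDeriv U (a + a') (b + b') := by
  refine (HasDerivAt.add h h').congr_of_eventuallyEq (Eventually.of_forall fun s => ?_)
  simp

omit hU [CompleteSpace E] in
lemma _root_.WalshSpider.HasGroupDeriv.smul (r : ℝ) {a b : E} (h : HasGroupDeriv U a b) :
    HasGroupDeriv U (r • a) (r • b) := by
  refine (HasDerivAt.const_smul r h).congr_of_eventuallyEq (Eventually.of_forall fun s => ?_)
  simp

/-- The Laplace transform of the group `U` at `1`. -/
lemma hasGroupDeriv_laplace (f : E) :
    HasGroupDeriv U (∫ s in Ioi (0 : ℝ), Real.exp (-s) • U s f)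
      ((∫ s in Ioi (0 : ℝ), Real.exp (-s) • U s f) - f) := by
  set g : ℝ → E := fun s => Real.exp (-s) • U s f with hg
  have hgc : Continuous g := by
    have := hU.continuous_apply f
    fun_prop
  have hgi : ∀ s : ℝ, IntegrableOn g (Ioi s) := by
    intro s
    refine Integrable.mono' ((integrableOn_exp_neg_Ioi s).mul_const ‖f‖)
      hgc.aestronglyMeasurable (Eventually.of_forall fun r => ?_)
    simp [hg, norm_smul, hU.norm_map]
  -- The group law turns `U s` into a translation of the integration variable, at the price of the
  -- factor `e^s`. The right-hand side can be differentiated in `s` for every `f`, differentiable or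
  -- not.
  have key : ∀ s, U s (∫ r in Ioi (0 : ℝ), g r) =
      Real.exp s • ((∫ r in Ioi (0 : ℝ), g r) - ∫ r in (0 : ℝ)..s, g r) := by
    intro s
    rw [← intervalIntegral.integral_Ioi_sub_Ioi' (hgi 0) (hgi s), sub_sub_cancel,
      ← (U s).integral_comp_comm (hgi 0)]
    have h1 := (measurePreserving_add_right volume s).setIntegral_preimage_emb
      (MeasurableEquiv.addRight s).measurableEmbedding g (Ioi s)
    have h2 : (fun x => x + s) ⁻¹' Ioi s = Ioi 0 := by ext x; simp
    rw [h2] at h1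
    rw [← h1, ← integral_smul]
    refine integral_congr_ae (Eventually.of_forall fun r => ?_)
    simp only [hg, map_smul, smul_smul, ← Real.exp_add, ← hU.map_add]
    congr 2
    · ring
    · rw [add_comm]
  have h1 : HasDerivAt (fun s => ∫ r in (0 : ℝ)..s, g r) (g 0) 0 :=
    intervalIntegral.integral_hasDerivAt_right (by simp)
      (hgc.stronglyMeasurableAtFilter _ _) hgc.continuousAt
  have h2 := (Real.hasDerivAt_exp 0).smul (h1.const_sub (∫ r in Ioi (0 : ℝ), g r))
  have h3 : g 0 = f := by simp [hg, hU.apply_zero]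
  rw [h3] at h2
  refine (h2.congr_of_eventuallyEq (Eventually.of_forall key)).congr_deriv ?_
  simp
  abel

/-- The equation `w - w'' = f` for the square of the generator of `U`; the solution inherits the
symmetries of `f`. -/
lemma exists_sub_eq (f : E) : ∃ w v, HasGroupDeriv U w v ∧ HasGroupDeriv U v (w - f) ∧
    ∀ (J : E →L[ℝ] E) (ε : ℝ), (∀ s u, J (U s u) = U (-s) (J u)) → J f = ε • f →
      J w = ε • w ∧ J v = -(ε • v) := by
  have hi : ∀ {V : ℝ → E →L[ℝ] E}, IsIsometryGroup V → ∀ f,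
      Integrable (fun s => Real.exp (-s) • V s f) (volume.restrict (Ioi (0 : ℝ))) := by
    intro V hV f
    have := hV.continuous_apply f
    refine Integrable.mono' ((integrableOn_exp_neg_Ioi 0).mul_const ‖f‖)
      (Continuous.aestronglyMeasurable (by fun_prop)) (Eventually.of_forall fun r => ?_)
    simp [norm_smul, hV.norm_map]
  -- For the generator `D` of `U`, `p = (1 - D)⁻¹ f` and `q = (1 + D)⁻¹ f`. Their half sum is `(1 -
  -- D²)⁻¹ f`, and its derivative is their half difference. An operator `J` reversing time exchanges
  -- `p` and `q` up to the factor `ε`.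
  set p := ∫ s in Ioi (0 : ℝ), Real.exp (-s) • U s f with hp
  set q := ∫ s in Ioi (0 : ℝ), Real.exp (-s) • U (-s) f with hq
  have h1 : HasGroupDeriv U p (p - f) := hU.hasGroupDeriv_laplace f
  have h2 : HasGroupDeriv U q (f - q) := by
    have := hasGroupDeriv_neg (hU.neg.hasGroupDeriv_laplace f)
    simpa only [neg_neg, neg_sub] using this
  refine ⟨(1 / 2 : ℝ) • (p + q), (1 / 2 : ℝ) • (p + (-1 : ℝ) • q), ?_, ?_, ?_⟩
  · convert (h1.add h2).smul (1 / 2) using 2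
    rw [neg_one_smul]; abel
  · convert (h1.add (h2.smul (-1))).smul (1 / 2) using 1
    module
  · intro J ε hJ hf
    have h3 : J p = ε • q := by
      rw [hp, hq, ← J.integral_comp_comm (hi hU f), ← integral_smul]
      refine integral_congr_ae (Eventually.of_forall fun r => ?_)
      simp only [map_smul, hJ, hf]
      exact smul_comm _ _ _
    have h4 : J q = ε • p := by
      rw [hp, hq, ← J.integral_comp_comm (hi hU.neg f), ← integral_smul]
      refine integral_congr_ae (Eventually.of_forall fun r => ?_)
      simp only [map_smul, hJ, hf, neg_neg]
      exact smul_comm _ _ _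
    rw [J.map_smul, J.map_smul, J.map_add, J.map_add, J.map_smul, h3, h4]
    constructor <;> module

end IsIsometryGroup

end IsometryGroup

/-! ### Translations and the heat semigroup on `L²(ℝ)` -/

section Line

/-- The real Hilbert space `L²(ℝ)`. -/
abbrev LineL2 : Type := Lp ℝ 2 (volume : Measure ℝ)

/-- The translation `f ↦ f(· + s)` of `L²(ℝ)`. -/
def shift (s : ℝ) : LineL2 →L[ℝ] LineL2 :=
  (Lp.compMeasurePreservingₗᵢ ℝ (fun x : ℝ => x + s)
    (measurePreserving_add_right volume s)).toContinuousLinearMap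

lemma coeFn_shift (s : ℝ) (f : LineL2) : shift s f =ᵐ[volume] fun x => f (x + s) :=
  Lp.coeFn_compMeasurePreserving f (measurePreserving_add_right volume s)

lemma ae_add_right {p : ℝ → Prop} (h : ∀ᵐ x, p x) (s : ℝ) : ∀ᵐ x, p (x + s) :=
  (measurePreserving_add_right volume s).quasiMeasurePreserving.ae h

lemma isIsometryGroup_shift : IsIsometryGroup shift where
  map_zero := by
    ext1 f
    refine Lp.ext ((coeFn_shift 0 f).trans ?_)
    simp
  map_add s t f := by
    refine Lp.ext ((coeFn_shift _ f).trans ?_)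
    filter_upwards [coeFn_shift s (shift t f), ae_add_right (coeFn_shift t f) s] with x h1 h2
    rw [h1, h2, add_assoc]
  continuous_apply f := by
    have hg : Continuous fun s : ℝ => (ContinuousMap.mk (fun x : ℝ => x + s) (by fun_prop)) :=
      ContinuousMap.continuous_of_continuous_uncurry _ (by
        simp only [Function.uncurry_def, ContinuousMap.coe_mk]; fun_prop)
    exact (continuous_const (y := f)).compMeasurePreservingLp hg
      (fun s => measurePreserving_add_right volume s) (by norm_num)
  norm_map s f := (Lp.compMeasurePreservingₗᵢ ℝ (fun x : ℝ => x + s)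
    (measurePreserving_add_right volume s)).norm_map f

lemma memLp_two_integrableOn {f : ℝ → ℝ} (hf : MemLp f 2 volume) {s : Set ℝ}
    (hs : volume s < ⊤) : IntegrableOn f s volume :=
  have : IsFiniteMeasure (volume.restrict s) := ⟨by simpa using hs⟩
  (hf.restrict s).integrable (by norm_num)

lemma intervalIntegrable_coeFn (f : LineL2) (a b : ℝ) : IntervalIntegrable f volume a b :=
  ⟨memLp_two_integrableOn (Lp.memLp f) (by simp), memLp_two_integrableOn (Lp.memLp f) (by simp)⟩

/-- Cauchy–Schwarz against the indicator of `A`; uniformity in `s` is what Fubini needs in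
`integrable_prod_shift`. -/
lemma setIntegral_norm_shift_le (f : LineL2) {A : Set ℝ} (hA : MeasurableSet A)
    (hA' : volume A < ⊤) : ∃ C, ∀ s, ∫ x in A, ‖f (x + s)‖ ≤ C := by
  refine ⟨‖indicatorConstLp 2 hA hA'.ne (1 : ℝ)‖ * ‖f‖, fun s => ?_⟩
  have h1 : ∫ x in A, ‖f (x + s)‖ = inner ℝ (indicatorConstLp 2 hA hA'.ne (1 : ℝ)) |shift s f| := by
    rw [L2.inner_indicatorConstLp_one]
    refine integral_congr_ae (ae_restrict_of_ae ?_)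
    filter_upwards [Lp.coeFn_abs (shift s f), coeFn_shift s f] with x h1 h2
    rw [h1, h2, Real.norm_eq_abs]
  rw [h1]
  refine (real_inner_le_norm _ _).trans_eq ?_
  rw [norm_abs_eq_norm, isIsometryGroup_shift.norm_map]

lemma integrable_prod_shift (ν : Measure ℝ) [IsFiniteMeasure ν] (f : LineL2) {A : Set ℝ}
    (hA : MeasurableSet A) (hA' : volume A < ⊤) :
    Integrable (fun z : ℝ × ℝ => f (z.1 + z.2)) ((volume.restrict A).prod ν) := by
  have hm : StronglyMeasurable fun z : ℝ × ℝ => f (z.1 + z.2) :=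
    (Lp.stronglyMeasurable f).comp_measurable (by fun_prop)
  rw [integrable_prod_iff' hm.aestronglyMeasurable]
  obtain ⟨C, hC⟩ := setIntegral_norm_shift_le f hA hA'
  constructor
  · refine Eventually.of_forall fun s => ?_
    exact memLp_two_integrableOn
      ((Lp.memLp f).comp_measurePreserving (measurePreserving_add_right volume s)) hA'
  · refine Integrable.of_bound
      (hm.norm.integral_prod_left' (μ := volume.restrict A)).aestronglyMeasurable C
      (Eventually.of_forall fun s => ?_)
    rw [Real.norm_of_nonneg (integral_nonneg fun _ => norm_nonneg _)]
    exact hC s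

lemma ae_integrable_shift (ν : Measure ℝ) [IsFiniteMeasure ν] (f : LineL2) :
    ∀ᵐ x, Integrable (fun s => f (x + s)) ν :=
  ae_of_forall_measure_lt_top_ae_restrict _ fun _ hA hA' =>
    (integrable_prod_shift ν f hA hA').prod_right_ae

/-- An average of translations is computed pointwise. -/
lemma coeFn_integral_shift (ν : Measure ℝ) [IsFiniteMeasure ν] (f : LineL2) :
    (∫ s, shift s f ∂ν : LineL2) =ᵐ[volume] fun x => ∫ s, f (x + s) ∂ν := by
  have hint : ∀ A, MeasurableSet A → volume A < ⊤ →
      IntegrableOn (fun x => ∫ s, f (x + s) ∂ν) A volume := fun A hA hA' =>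
    (integrable_prod_shift ν f hA hA').integral_prod_left
  have hm : StronglyMeasurable fun x => ∫ s, f (x + s) ∂ν :=
    ((Lp.stronglyMeasurable f).comp_measurable (by fun_prop) :
      StronglyMeasurable fun z : ℝ × ℝ => f (z.1 + z.2)).integral_prod_right'
  -- Both sides are compared through their integrals over sets of finite measure: on the left,
  -- integration over `A` is a continuous functional and passes inside the vector-valued integral;
  -- on the right, Fubini applies.
  refine ae_eq_of_forall_setIntegral_eq_of_sigmaFinite
    (fun A hA hA' => memLp_two_integrableOn (Lp.memLp _) hA') hint fun A hA hA' => ?_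
  have h1 := integral_integral_swap (f := fun x s => f (x + s)) (integrable_prod_shift ν f hA hA')
  rw [h1, ← L2.inner_indicatorConstLp_one (𝕜 := ℝ) hA hA'.ne]
  have h2 := (innerSL ℝ (indicatorConstLp 2 hA hA'.ne (1 : ℝ))).integral_comp_comm
    (isIsometryGroup_shift.integrable_apply ν f)
  simp only [innerSL_apply_apply] at h2
  rw [← h2]
  refine integral_congr_ae (Eventually.of_forall fun s => ?_)
  simp only
  rw [L2.inner_indicatorConstLp_one]
  exact integral_congr_ae (ae_restrict_of_ae (coeFn_shift s f))

lemma coeFn_intervalIntegral_shift (f : LineL2) (s : ℝ) :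
    (∫ r in 0..s, shift r f : LineL2) =ᵐ[volume] fun x => ∫ y in x..x + s, f y := by
  rw [intervalIntegral]
  filter_upwards [Lp.coeFn_sub (∫ r in Ioc 0 s, shift r f) (∫ r in Ioc s 0, shift r f),
    coeFn_integral_shift (volume.restrict (Ioc 0 s)) f,
    coeFn_integral_shift (volume.restrict (Ioc s 0)) f] with x h1 h2 h3
  rw [h1, Pi.sub_apply, h2, h3]
  have h4 := intervalIntegral.integral_comp_add_left (a := 0) (b := s) (fun y => f y) x
  rw [add_zero] at h4
  rw [← h4, intervalIntegral]

/-- The differentiable vectors of the translation group are the absolutely continuous functions. -/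
lemma hasGroupDeriv_shift_iff {a b : LineL2} :
    HasGroupDeriv shift a b ↔ ∃ c : ℝ, a =ᵐ[volume] fun x => c + ∫ y in 0..x, b y := by
  have hH : ∀ x s, ∫ y in x..x + s, b y = (∫ y in 0..x + s, b y) - ∫ y in 0..x, b y := fun x s =>
    (intervalIntegral.integral_interval_sub_left (intervalIntegrable_coeFn b _ _)
      (intervalIntegrable_coeFn b _ _)).symm
  constructor
  · intro h
    set D : ℝ → ℝ := fun x => a x - ∫ y in 0..x, b y with hD
    have hDm : Measurable D := (Lp.stronglyMeasurable a).measurable.sub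
      (intervalIntegral.continuous_primitive (intervalIntegrable_coeFn b) 0).measurable
    have h1 : ∀ s, ∀ᵐ x, D (x + s) = D x := by
      intro s
      have h2 := isIsometryGroup_shift.integral_eq_sub h s
      filter_upwards [coeFn_intervalIntegral_shift b s, Lp.coeFn_sub (shift s a) a,
        coeFn_shift s a] with x e1 e2 e3
      rw [h2, e2, Pi.sub_apply, e3, hH] at e1
      simp only [hD]
      linarith
    -- For each `s`, `D` is invariant under translation by `s` off a null set depending on `s`.
    -- Fubini exchanges the quantifiers, and a single good `x` then shows that `D` is a.e. equal to
    -- `D x`.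
    have h3 : ∀ᵐ x, ∀ᵐ s, D (x + s) = D x := by
      have hms : MeasurableSet {z : ℝ × ℝ | D (z.1 + z.2) = D z.1} :=
        measurableSet_eq_fun (by fun_prop) (by fun_prop)
      exact (Measure.ae_ae_comm hms).2 (Eventually.of_forall h1)
    obtain ⟨x, hx⟩ := h3.exists
    refine ⟨D x, ?_⟩
    filter_upwards [ae_add_right hx (-x)] with y hy
    rw [← hy]
    simp [hD]
  · rintro ⟨c, hc⟩
    refine isIsometryGroup_shift.hasGroupDeriv_of_integral fun s => Lp.ext ?_
    filter_upwards [coeFn_intervalIntegral_shift b s, Lp.coeFn_sub (shift s a) a,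
      coeFn_shift s a, hc, ae_add_right hc s] with x e1 e2 e3 e4 e5
    rw [e1, e2, Pi.sub_apply, e3, e4, e5, hH]
    ring

/-- The reflection `f ↦ f(-·)` of `L²(ℝ)`. -/
def reflect : LineL2 →L[ℝ] LineL2 :=
  (Lp.compMeasurePreservingₗᵢ ℝ (fun x : ℝ => -x)
    (Measure.measurePreserving_neg volume)).toContinuousLinearMap

lemma coeFn_reflect (f : LineL2) : reflect f =ᵐ[volume] fun x => f (-x) :=
  Lp.coeFn_compMeasurePreserving f (Measure.measurePreserving_neg volume)

lemma ae_neg {p : ℝ → Prop} (h : ∀ᵐ x, p x) : ∀ᵐ x, p (-x) :=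
  (Measure.measurePreserving_neg (volume : Measure ℝ)).quasiMeasurePreserving.ae h

lemma reflect_shift (s : ℝ) (f : LineL2) : reflect (shift s f) = shift (-s) (reflect f) := by
  refine Lp.ext ?_
  filter_upwards [coeFn_reflect (shift s f), ae_neg (coeFn_shift s f), coeFn_shift (-s) (reflect f),
    ae_add_right (coeFn_reflect f) (-s)] with x h1 h2 h3 h4
  rw [h1, h2, h3, h4]
  congr 1
  ring

/-- The heat semigroup of the line. -/
abbrev lineHeat (t : ℝ≥0) : LineL2 →L[ℝ] LineL2 := isIsometryGroup_shift.heat t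

/-- Reflection reverses translations, and the Gaussian law is symmetric; so the heat flow of the
line preserves parity. -/
lemma reflect_lineHeat (t : ℝ≥0) (f : LineL2) :
    reflect (lineHeat t f) = lineHeat t (reflect f) := by
  have hc : ∀ g, Continuous fun r => shift (√(2 * t) * r) g := fun g =>
    (isIsometryGroup_shift.continuous_apply g).comp (by fun_prop)
  have hi : Integrable (fun r => shift (√(2 * t) * r) f) (ProbabilityTheory.gaussianReal 0 1) :=
    Integrable.of_bound (hc f).aestronglyMeasurable ‖f‖
      (Eventually.of_forall fun s => (isIsometryGroup_shift.norm_map _ f).le)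
  rw [lineHeat, isIsometryGroup_shift.heat_apply, isIsometryGroup_shift.heat_apply,
    ← reflect.integral_comp_comm hi]
  have h : ProbabilityTheory.gaussianReal 0 1
      = (ProbabilityTheory.gaussianReal 0 1).map (fun x => -x) := by
    rw [ProbabilityTheory.gaussianReal_map_neg, neg_zero]
  conv_rhs => rw [h]
  rw [integral_map (by fun_prop) (hc _).aestronglyMeasurable]
  simp [reflect_shift]

lemma gaussianPDFReal_eq_gauss (t : ℝ≥0) (u : ℝ) :
    ProbabilityTheory.gaussianPDFReal 0 (2 * t) u = gauss t u := by
  rw [ProbabilityTheory.gaussianPDFReal, gauss, div_eq_mul_inv, mul_comm]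
  push_cast
  congr 2
  · rw [sub_zero]; ring
  · congr 1; ring

/-- The heat semigroup of the line has the Gaussian kernel. -/
lemma coeFn_lineHeat {t : ℝ≥0} (ht : 0 < t) (f : LineL2) :
    ∀ᵐ x, Integrable (fun y => gauss t (x - y) * f y) volume ∧
      lineHeat t f x = ∫ y, gauss t (x - y) * f y := by
  have hv : 2 * t ≠ 0 := by positivity
  filter_upwards [ae_integrable_shift (ProbabilityTheory.gaussianReal 0 (2 * t)) f,
    coeFn_integral_shift (ProbabilityTheory.gaussianReal 0 (2 * t)) f] with x h1 h2
  have hsymm : ∀ y, gauss t (x - y) = gauss t (y - x) := fun y => by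
    rw [gauss, gauss, ← neg_sub, neg_sq]
  have e : (fun y => gauss t (x - y) * f y) =
      fun y => (fun s => gauss t s * f (x + s)) (y - x) := by
    funext y
    simp [hsymm]
  constructor
  · rw [e]
    refine Integrable.comp_sub_right (f := fun s => gauss t s * f (x + s)) ?_ x
    rw [ProbabilityTheory.gaussianReal_of_var_ne_zero _ hv,
      integrable_withDensity_iff_integrable_smul' (by fun_prop)
        (ae_of_all _ fun _ => ProbabilityTheory.gaussianPDF_lt_top)] at h1
    refine h1.congr (Eventually.of_forall fun s => ?_)
    simp only [ProbabilityTheory.toReal_gaussianPDF, smul_eq_mul, gaussianPDFReal_eq_gauss]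
  · rw [lineHeat, IsIsometryGroup.heat, IsIsometryGroup.average_apply, h2,
      ProbabilityTheory.integral_gaussianReal_eq_integral_smul hv, e,
      integral_sub_right_eq_self (fun s => gauss t s * f (x + s)) x]
    simp only [smul_eq_mul, gaussianPDFReal_eq_gauss]

end Line

/-! ### Even and odd extension, heat semigroups of the half-line, and weak derivatives -/

section HalfLine

/-- Restriction of functions from the line to the half-line. -/
def restr : LineL2 →L[ℝ] LegL2 := LpToLpRestrictCLM ℝ ℝ ℝ volume 2 (Ioi 0)

lemma coeFn_restr (a : LineL2) : restr a =ᵐ[legMeasure] a := LpToLpRestrictCLM_coeFn ℝ (Ioi 0) a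

/-- Extension of functions from the half-line to the line by `0`. -/
def extendZero : LegL2 →L[ℝ] LineL2 := ContinuousLinearMap.adjoint restr

lemma ae_leg_iff {p : ℝ → Prop} : (∀ᵐ x ∂legMeasure, p x) ↔ ∀ᵐ x, 0 < x → p x :=
  ae_restrict_iff' measurableSet_Ioi

lemma coeFn_extendZero (u : LegL2) : extendZero u =ᵐ[volume] (Ioi 0).indicator u := by
  have hm : MemLp ((Ioi 0).indicator u) 2 volume :=
    (memLp_indicator_iff_restrict measurableSet_Ioi).2 (Lp.memLp u)
  have h : extendZero u = hm.toLp _ := by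
    refine ext_inner_right ℝ fun b => ?_
    rw [extendZero, ContinuousLinearMap.adjoint_inner_left, L2.inner_def, L2.inner_def,
      ← integral_indicator measurableSet_Ioi]
    refine integral_congr_ae ?_
    filter_upwards [hm.coeFn_toLp, ae_leg_iff.1 (coeFn_restr b)] with x h1 h2
    rw [h1]
    by_cases hx : x ∈ Ioi (0 : ℝ)
    · simp [hx, h2 hx]
    · simp [hx]
  rw [h]
  exact hm.coeFn_toLp

/-- The extension of a function from the half-line to the line that is even for `ε = 1` and odd
for `ε = -1`. -/
def extend (ε : ℝ) : LegL2 →L[ℝ] LineL2 := extendZero + ε • (reflect.comp extendZero)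

lemma extend_apply (ε : ℝ) (u : LegL2) :
    extend ε u = extendZero u + ε • reflect (extendZero u) := rfl

lemma coeFn_extend (ε : ℝ) (u : LegL2) :
    ∀ᵐ x, (0 < x → extend ε u x = u x) ∧ (x < 0 → extend ε u x = ε * u (-x)) := by
  filter_upwards [Lp.coeFn_add (extendZero u) (ε • reflect (extendZero u)),
    Lp.coeFn_smul ε (reflect (extendZero u)), coeFn_reflect (extendZero u),
    coeFn_extendZero u, ae_neg (coeFn_extendZero u)] with x h1 h2 h3 h4 h5
  rw [extend_apply, h1, Pi.add_apply, h2, Pi.smul_apply, h3, h4, h5, smul_eq_mul]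
  constructor
  · intro hx
    simp [hx, hx.le]
  · intro hx
    simp [hx, hx.le]

lemma ae_ne_zero : ∀ᵐ x : ℝ, x ≠ 0 := by simp [ae_iff]

lemma restr_extend (ε : ℝ) (u : LegL2) : restr (extend ε u) = u := by
  refine Lp.ext (ae_leg_iff.2 ?_)
  filter_upwards [ae_leg_iff.1 (coeFn_restr (extend ε u)), coeFn_extend ε u] with x h1 h2 hx
  rw [h1 hx, h2.1 hx]

lemma reflect_extend {ε : ℝ} (hε : ε * ε = 1) (u : LegL2) :
    reflect (extend ε u) = ε • extend ε u := by
  refine Lp.ext ?_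
  filter_upwards [coeFn_reflect (extend ε u), coeFn_extend ε u, ae_neg (coeFn_extend ε u),
    Lp.coeFn_smul ε (extend ε u), ae_ne_zero] with x h1 h2 h3 h4 h5
  rw [h1, h4, Pi.smul_apply, smul_eq_mul]
  rcases lt_or_gt_of_ne h5 with hx | hx
  · rw [h3.1 (by linarith), h2.2 hx, ← mul_assoc, hε, one_mul]
  · rw [h3.2 (by linarith), h2.1 hx, neg_neg]

lemma extend_restr {ε : ℝ} (hε : ε * ε = 1) {a : LineL2} (ha : reflect a = ε • a) :
    extend ε (restr a) = a := by
  refine Lp.ext ?_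
  have h0 := coeFn_reflect a
  rw [ha] at h0
  filter_upwards [ae_leg_iff.1 (coeFn_restr a), ae_neg (ae_leg_iff.1 (coeFn_restr a)),
    coeFn_extend ε (restr a), Lp.coeFn_smul ε a, h0, ae_ne_zero] with x h1 h2 h3 h4 h5 h6
  rcases lt_or_gt_of_ne h6 with hx | hx
  · rw [h3.2 hx, h2 (by linarith), ← h5, h4, Pi.smul_apply, smul_eq_mul, ← mul_assoc, hε, one_mul]
  · rw [h3.1 hx, h1 hx]

/-- Up to the factor `√2` the extension is isometric, so contractivity passes from the line to the
half-line. -/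
lemma norm_extend_sq {ε : ℝ} (hε : ε * ε = 1) (u : LegL2) : ‖extend ε u‖ ^ 2 = 2 * ‖u‖ ^ 2 := by
  have h1 : ∀ b, inner ℝ (extendZero u) b = inner ℝ u (restr b) := fun b =>
    ContinuousLinearMap.adjoint_inner_left restr b u
  have h2 : inner ℝ (reflect (extendZero u)) (extend ε u)
      = ε * inner ℝ (extendZero u) (extend ε u) := by
    have e := (Lp.compMeasurePreservingₗᵢ ℝ (fun x : ℝ => -x)
      (Measure.measurePreserving_neg volume)).inner_map_map (extendZero u) (reflect (extend ε u))
      (𝕜 := ℝ) (E := LineL2) (E' := LineL2)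
    change inner ℝ (reflect (extendZero u)) (reflect (reflect (extend ε u))) = _ at e
    rw [reflect_extend hε, map_smul, reflect_extend hε, smul_smul, hε, one_smul] at e
    rw [e, inner_smul_right]
  rw [← real_inner_self_eq_norm_sq, ← real_inner_self_eq_norm_sq]
  conv_lhs => arg 2; rw [extend_apply]
  rw [inner_add_left, real_inner_smul_left, h2, h1, restr_extend, ← mul_assoc, hε]
  ring

/-- The heat semigroup of the half-line, with the Neumann condition at `0` for `ε = 1` and the
Dirichlet condition for `ε = -1`. -/
def legHeat (ε : ℝ) (t : ℝ≥0) : LegL2 →L[ℝ] LegL2 := restr.comp ((lineHeat t).comp (extend ε))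

lemma legHeat_apply (ε : ℝ) (t : ℝ≥0) (u : LegL2) :
    legHeat ε t u = restr (lineHeat t (extend ε u)) := rfl

/-- By preservation of parity, restricting to the half-line loses nothing: this gives the semigroup
law of `legHeat`. -/
lemma extend_legHeat {ε : ℝ} (hε : ε * ε = 1) (t : ℝ≥0) (u : LegL2) :
    extend ε (legHeat ε t u) = lineHeat t (extend ε u) := by
  rw [legHeat_apply, extend_restr hε]
  rw [reflect_lineHeat, reflect_extend hε, map_smul]

lemma isContractionSemigroup_legHeat {ε : ℝ} (hε : ε * ε = 1) :
    IsContractionSemigroup (legHeat ε) where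
  map_zero := by
    ext1 u
    rw [legHeat_apply, lineHeat, isIsometryGroup_shift.heat_zero]
    exact restr_extend ε u
  map_add s t := by
    ext1 u
    rw [ContinuousLinearMap.comp_apply, legHeat_apply, legHeat_apply ε s, extend_legHeat hε,
      lineHeat, isIsometryGroup_shift.heat_add]
    rfl
  continuous_apply u := restr.continuous.comp (isIsometryGroup_shift.continuous_heat _)
  norm_le t u := by
    have h1 := norm_extend_sq hε (legHeat ε t u)
    have h2 := norm_extend_sq hε u
    rw [extend_legHeat hε] at h1
    have h3 := isIsometryGroup_shift.isContractionSemigroup_heat.norm_le t (extend ε u)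
    have h4 := pow_le_pow_left₀ (norm_nonneg _) h3 2
    rw [h1, h2] at h4
    exact le_of_sq_le_sq (by linarith) (norm_nonneg _)

/-- The kernel of the heat semigroup of the half-line. -/
lemma coeFn_legHeat (ε : ℝ) {t : ℝ≥0} (ht : 0 < t) (u : LegL2) :
    ∀ᵐ x ∂legMeasure,
      Integrable (fun y => (gauss t (x - y) + ε * gauss t (x + y)) * u y) legMeasure ∧
        legHeat ε t u x = ∫ y in Ioi 0, (gauss t (x - y) + ε * gauss t (x + y)) * u y := by
  have h0 : ∀ᵐ y ∂legMeasure, extend ε u y = u y ∧ extend ε u (-y) = ε * u y := by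
    refine ae_leg_iff.2 ?_
    filter_upwards [coeFn_extend ε u, ae_neg (coeFn_extend ε u)] with y h1 h2 hy
    exact ⟨h1.1 hy, by rw [h2.2 (by linarith), neg_neg]⟩
  filter_upwards [ae_restrict_of_ae (coeFn_lineHeat ht (extend ε u)),
    coeFn_restr (lineHeat t (extend ε u))] with x hx h1
  obtain ⟨hi, he⟩ := hx
  set F : ℝ → ℝ := fun y => gauss t (x - y) * extend ε u y with hF
  -- Method of images: the integral over the negative half-line is folded onto the positive one,
  -- where parity produces the term `ε g_t(x + y)`.
  have hF2 : (fun y => F y + F (-y)) =ᵐ[legMeasure]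
      fun y => (gauss t (x - y) + ε * gauss t (x + y)) * u y := by
    filter_upwards [h0] with y hy
    simp only [hF, hy.1, hy.2, sub_neg_eq_add]
    ring
  have hi1 : Integrable F legMeasure := hi.restrict
  have hi2 : Integrable (fun y => F (-y)) legMeasure := hi.comp_neg.restrict
  refine ⟨(hi1.add hi2).congr hF2, ?_⟩
  rw [legHeat_apply, h1, he, ← integral_congr_ae hF2, integral_add hi1 hi2,
    integral_comp_neg_Ioi, neg_zero, add_comm]
  exact (intervalIntegral.integral_Iic_add_Ioi hi.integrableOn hi.integrableOn).symm

lemma locallyIntegrable_coeFn (f : LineL2) : LocallyIntegrable f volume :=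
  (Lp.memLp f).locallyIntegrable (by norm_num)

lemma continuous_primitive_coeFn (f : LineL2) : Continuous fun x => ∫ y in 0..x, f y :=
  intervalIntegral.continuous_primitive (intervalIntegrable_coeFn f) 0

/-- Integration by parts of a primitive of an `L²` function against a test function. -/
lemma integral_primitive_mul_deriv (b : LineL2) {φ : ℝ → ℝ} (hφ : ContDiff ℝ ∞ φ)
    (hc : HasCompactSupport φ) :
    ∫ x, (∫ y in 0..x, b y) * deriv φ x = - ∫ x, b x * φ x := by
  obtain ⟨R, hR⟩ := hc.isCompact.isBounded.subset_ball 0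
  rw [Real.ball_eq_Ioo, zero_sub, zero_add] at hR
  have hsub : ∀ ψ : ℝ → ℝ, tsupport ψ ⊆ tsupport φ → ∀ f : ℝ → ℝ,
      ∫ x, f x * ψ x = ∫ x in -R..R, f x * ψ x := by
    intro ψ hψ f
    refine (intervalIntegral.integral_eq_integral_of_support_subset ?_).symm
    exact (Function.support_mul_subset_right f ψ).trans
      ((subset_tsupport ψ).trans (hψ.trans (hR.trans Ioo_subset_Ioc_self)))
  have hz : ∀ x, x ∉ Ioo (-R) R → φ x = 0 := fun x hx =>
    image_eq_zero_of_notMem_tsupport fun h => hx (hR h)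
  rw [hsub _ tsupport_deriv_subset _, hsub φ subset_rfl]
  rcases le_total 0 R with h0 | h0
  -- The primitive is only absolutely continuous. The boundary terms vanish because the support of
  -- `φ` lies in the open interval `(-R, R)`.
  · have h1 := (intervalIntegrable_coeFn b (-R) R).absolutelyContinuousOnInterval_intervalIntegral
      (c := 0) (by rw [mem_uIcc]; left; constructor <;> linarith)
    have h2 : AbsolutelyContinuousOnInterval φ (-R) R :=
      (hφ.of_le (by norm_num)).contDiffOn.absolutelyContinuousOnInterval
    rw [h1.integral_mul_deriv_eq_deriv_mul h2, hz R (by simp), hz (-R) (by simp)]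
    simp only [mul_zero, sub_zero, zero_sub]
    congr 1
    refine intervalIntegral.integral_congr_ae ?_
    filter_upwards [_root_.LocallyIntegrable.ae_hasDerivAt_integral
      (locallyIntegrable_coeFn b)] with x hx _
    rw [(hx 0).deriv]
  · have hφ0 : φ = 0 := by
      funext x
      exact hz x fun h => by linarith [h.1, h.2]
    simp [hφ0]

/-- A test function on `(0, ∞)` with integral `0` is the derivative of a test function. -/
lemma exists_primitive_of_integral_eq_zero {η : ℝ → ℝ} (hη : ContDiff ℝ ∞ η)
    (hc : HasCompactSupport η) (hs : tsupport η ⊆ Ioi 0) (h0 : ∫ x, η x = 0) :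
    ∃ θ : ℝ → ℝ, ContDiff ℝ ∞ θ ∧ HasCompactSupport θ ∧ tsupport θ ⊆ Ioi 0 ∧ deriv θ = η := by
  have hK := hc.isCompact
  -- A positive lower bound of the support keeps the primitive supported away from `0`; any value
  -- serves if the support is empty.
  obtain ⟨a, ha, haK⟩ : ∃ a : ℝ, 0 < a ∧ ∀ x ∈ tsupport η, a ≤ x := by
    rcases (tsupport η).eq_empty_or_nonempty with h | h
    · exact ⟨1, one_pos, by simp [h]⟩
    · exact ⟨sInf (tsupport η), hs (hK.sInf_mem h), fun x hx => csInf_le hK.bddBelow hx⟩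
  obtain ⟨R, hR⟩ := hK.bddAbove
  have hz : ∀ x, x ∉ Icc a R → η x = 0 := fun x hx =>
    image_eq_zero_of_notMem_tsupport fun h => hx ⟨haK x h, hR h⟩
  have hi : Integrable η volume := hη.continuous.integrable_of_hasCompactSupport hc
  have hd : ∀ x, HasDerivAt (fun x => ∫ y in 0..x, η y) (η x) x := fun x =>
    intervalIntegral.integral_hasDerivAt_right hi.intervalIntegrable
      (hη.continuous.stronglyMeasurableAtFilter _ _) hη.continuous.continuousAt
  have hd' : deriv (fun x => ∫ y in 0..x, η y) = η := funext fun x => (hd x).deriv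
  have hsupp : tsupport (fun x => ∫ y in 0..x, η y) ⊆ Icc a R := by
    refine closure_minimal (fun x hx => ?_) isClosed_Icc
    by_contra hx'
    refine hx ?_
    have hioi : ∫ y in Ioi (0 : ℝ), η y = 0 := by
      rw [setIntegral_eq_integral_of_forall_compl_eq_zero, h0]
      intro y hy
      exact hz y fun h => hy (ha.trans_le h.1)
    -- Left of `a` the integrand is zero on the whole range; right of `R` the primitive has reached
    -- the total integral, which is `0`.
    rcases lt_or_ge x a with hxa | hxa
    · refine (intervalIntegral.integral_congr (g := 0) fun y hy => ?_).trans (by simp)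
      refine hz y fun h => ?_
      rw [mem_uIcc] at hy
      rcases hy with hy | hy <;> linarith [h.1, hy.1, hy.2]
    · have hxR : R < x := lt_of_not_ge fun h => hx' ⟨hxa, h⟩
      have h1 := intervalIntegral.integral_interval_add_Ioi (a := 0) (b := x) hi.integrableOn
        hi.integrableOn
      have h2 : ∫ y in Ioi x, η y = 0 := by
        refine (setIntegral_congr_fun (g := 0) measurableSet_Ioi fun y hy => ?_).trans (by simp)
        exact hz y fun h => absurd (hxR.trans hy) (not_lt.2 h.2)
      rw [h2, add_zero, hioi] at h1
      exact h1
  refine ⟨fun x => ∫ y in 0..x, η y, ?_, ?_, hsupp.trans fun x hx => ha.trans_le hx.1, hd'⟩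
  · rw [contDiff_infty_iff_deriv, hd']
    exact ⟨fun x => (hd x).differentiableAt, hη⟩
  · exact isCompact_Icc.of_isClosed_subset (isClosed_tsupport _) hsupp

/-- The lemma of du Bois-Reymond on the half-line. -/
lemma ae_eq_const_of_integral_mul_deriv_eq_zero {D : ℝ → ℝ} (hD : LocallyIntegrable D volume)
    (h : ∀ φ : ℝ → ℝ, ContDiff ℝ ∞ φ → HasCompactSupport φ → tsupport φ ⊆ Ioi 0 →
      ∫ x, D x * deriv φ x = 0) : ∃ c : ℝ, D =ᵐ[legMeasure] fun _ => c := by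
  -- A fixed test function `ψ` of integral `1`, supported in `[1, 3]`. For any test function `φ`,
  -- subtracting `(∫ φ) ψ` makes the integral zero, hence leaves a derivative; so `D` pairs with `φ`
  -- as the constant `∫ D ψ` does.
  let B : ContDiffBump (2 : ℝ) := ⟨1 / 2, 1, by norm_num, by norm_num⟩
  set ψ : ℝ → ℝ := B.normed volume with hψ
  have hψs : tsupport ψ ⊆ Ioi 0 := by
    rw [hψ, B.tsupport_normed_eq, Real.closedBall_eq_Icc]
    intro x hx
    have h1 : (2 : ℝ) - 1 ≤ x := hx.1
    exact mem_Ioi.2 (by linarith)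
  have hψd : ContDiff ℝ ∞ ψ := B.contDiff_normed
  have hψc : HasCompactSupport ψ := B.hasCompactSupport_normed
  have hψ1 : ∫ x, ψ x = 1 := B.integral_normed
  have hint : ∀ φ : ℝ → ℝ, Continuous φ → HasCompactSupport φ →
      Integrable (fun x => D x * φ x) volume := fun φ hφ hc => by
    simpa [mul_comm] using hD.integrable_smul_left_of_hasCompactSupport hφ hc
  set c := ∫ x, D x * ψ x with hc
  refine ⟨c, ae_leg_iff.2 ?_⟩
  have hDc : LocallyIntegrable (fun x => D x - c) volume := hD.sub (locallyIntegrable_const c)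
  have key := isOpen_Ioi.ae_eq_zero_of_integral_contDiff_smul_eq_zero
    (hDc.locallyIntegrableOn (Ioi 0)) (fun φ hφ hφc hφs => by
      set m := ∫ x, φ x with hm
      have hηs : tsupport (fun x => φ x - m * ψ x) ⊆ tsupport φ ∪ tsupport ψ :=
        (tsupport_sub φ fun x => m * ψ x).trans
          (union_subset_union_right _ (tsupport_mul_subset_right))
      have hψi : Integrable (fun x => m * ψ x) volume := B.integrable_normed.const_mul m
      have hφi : Integrable φ volume := hφ.continuous.integrable_of_hasCompactSupport hφc
      obtain ⟨θ, h1, h2, h3, h4⟩ := exists_primitive_of_integral_eq_zero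
        (η := fun x => φ x - m * ψ x) (hφ.sub (contDiff_const.mul hψd))
        (HasCompactSupport.sub hφc hψc.mul_left) (hηs.trans (union_subset hφs hψs)) (by
          rw [integral_sub hφi hψi, integral_const_mul, hψ1, mul_one, sub_self])
      have h5 := h θ h1 h2 h3
      rw [h4] at h5
      have h6 : ∀ x, D x * (φ x - m * ψ x) = D x * φ x - m * (D x * ψ x) := fun x => by ring
      simp only [h6] at h5
      rw [integral_sub (hint φ hφ.continuous hφc)
        ((hint ψ hψd.continuous hψc).const_mul m), integral_const_mul, ← hc] at h5
      have h7 : ∀ x, φ x • (D x - c) = D x * φ x - c * φ x := fun x => by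
        rw [smul_eq_mul]; ring
      simp only [h7]
      rw [integral_sub (hint φ hφ.continuous hφc) (hφi.const_mul c), integral_const_mul, ← hm]
      linarith)
  filter_upwards [key] with x hx hx0
  exact sub_eq_zero.1 (hx hx0)

lemma integral_restr_mul {φ : ℝ → ℝ} (hs : tsupport φ ⊆ Ioi 0) (a : LineL2) :
    ∫ x in Ioi 0, restr a x * φ x = ∫ x, a x * φ x := by
  rw [← setIntegral_eq_integral_of_forall_compl_eq_zero (μ := volume) (s := Ioi 0)
    (f := fun x => a x * φ x) fun x hx => by
      rw [image_eq_zero_of_notMem_tsupport fun h => hx (hs h), mul_zero]]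
  refine integral_congr_ae ?_
  filter_upwards [coeFn_restr a] with x hx
  rw [hx]

/-- A function with a weak derivative in `L²` is absolutely continuous. -/
lemma HasWeakDeriv.exists_eq_integral {f g : LegL2} (h : HasWeakDeriv f g) :
    ∃ c : ℝ, HasTrace f c ∧ f =ᵐ[legMeasure] fun x => c + ∫ y in 0..x, extend 1 g y := by
  set a := extend 1 f
  set b := extend 1 g
  have hD : LocallyIntegrable (fun x => a x - ∫ y in 0..x, b y) volume :=
    (locallyIntegrable_coeFn a).sub (continuous_primitive_coeFn b).locallyIntegrable
  obtain ⟨c, hc⟩ := ae_eq_const_of_integral_mul_deriv_eq_zero hD fun φ hφ hφc hφs => by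
    have h1 := h φ hφ hφc hφs
    rw [← restr_extend 1 f, ← restr_extend 1 g, integral_restr_mul hφs,
      integral_restr_mul (tsupport_deriv_subset.trans hφs)] at h1
    have h2 := integral_primitive_mul_deriv b hφ hφc
    have hd := hφ.continuous_deriv (by norm_num)
    have i1 := (locallyIntegrable_coeFn a).integrable_smul_left_of_hasCompactSupport hd hφc.deriv
    have i2 := (continuous_primitive_coeFn b).locallyIntegrable (μ := volume)
      |>.integrable_smul_left_of_hasCompactSupport hd hφc.deriv
    simp only [smul_eq_mul, mul_comm (deriv φ _)] at i1 i2
    simp only [sub_mul]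
    rw [integral_sub i1 i2, h1, h2, sub_self]
  have hf : f =ᵐ[legMeasure] fun x => c + ∫ y in 0..x, b y := by
    filter_upwards [hc, ae_leg_iff.2 ((coeFn_extend 1 f).mono fun x hx => hx.1)] with x h1 h2
    rw [← h1, ← h2]
    ring
  exact ⟨c, ⟨_, (continuous_const.add (continuous_primitive_coeFn b)).continuousOn, by simp, hf⟩,
    hf⟩

end HalfLine

/-! ### Sobolev functions on the half-line as differentiable vectors of the translation group -/

section HalfLineCalculus

lemma HasTrace.unique {f : LegL2} {c c' : ℝ} (h : HasTrace f c) (h' : HasTrace f c') : c = c' := by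
  obtain ⟨F, hF, rfl, he⟩ := h
  obtain ⟨G, hG, rfl, he'⟩ := h'
  have h1 : F =ᵐ[volume.restrict (Ici 0)] G := by
    rw [← restrict_Ioi_eq_restrict_Ici]
    exact he.symm.trans he'
  exact Measure.eqOn_of_ae_eq h1 hF hG (by simp) self_mem_Ici

/-- Functions on the half-line with a weak derivative extend to absolutely continuous functions on
the line: always, if the extension is even, and if the trace is `0`, if the extension is odd. -/
lemma HasWeakDeriv.hasGroupDeriv_extend {ε c : ℝ} (hε : ε * ε = 1) {f g : LegL2}
    (h : HasWeakDeriv f g) (ht : HasTrace f c) (hc : ε * c = c) :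
    HasGroupDeriv shift (extend ε f) (extend (-ε) g) := by
  obtain ⟨c', ht', hf⟩ := h.exists_eq_integral
  obtain rfl := ht.unique ht'
  refine hasGroupDeriv_shift_iff.2 ⟨c, ?_⟩
  have hpos : ∀ x : ℝ, 0 < x → ∫ y in 0..x, extend 1 g y = ∫ y in 0..x, extend (-ε) g y := by
    intro x hx
    refine intervalIntegral.integral_congr_ae ?_
    filter_upwards [coeFn_extend 1 g, coeFn_extend (-ε) g] with y h1 h2 hy
    rw [uIoc_of_le hx.le] at hy
    rw [h1.1 hy.1, h2.1 hy.1]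
  -- A primitive from `0` of a function of parity `-ε` has parity `ε`. The constant `c` is
  -- compatible with this parity because `ε c = c`, which forces a zero trace in the odd case.
  have hneg : ∀ x : ℝ, x < 0 →
      ∫ y in 0..(-x), extend 1 g y = ε * ∫ y in 0..x, extend (-ε) g y := by
    intro x hx
    have h1 : ∫ y in 0..(-x), extend 1 g y = ∫ y in 0..(-x), -ε * extend (-ε) g (-y) := by
      refine intervalIntegral.integral_congr_ae ?_
      filter_upwards [coeFn_extend 1 g, ae_neg (coeFn_extend (-ε) g)] with y h1 h2 hy
      rw [uIoc_of_le (by linarith)] at hy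
      rw [h1.1 hy.1, h2.2 (by linarith [hy.1]), neg_neg, ← mul_assoc, neg_mul_neg, hε, one_mul]
    rw [h1, intervalIntegral.integral_const_mul,
      intervalIntegral.integral_comp_neg (fun y => extend (-ε) g y), neg_neg, neg_zero,
      intervalIntegral.integral_symm]
    ring
  filter_upwards [coeFn_extend ε f, ae_leg_iff.1 hf, ae_neg (ae_leg_iff.1 hf), ae_ne_zero]
    with x h1 h2 h3 h4
  rcases lt_or_gt_of_ne h4 with hx | hx
  · rw [h1.2 hx, h3 (by linarith), hneg x hx, mul_add, ← mul_assoc, hε, hc, one_mul]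
  · rw [h1.1 hx, h2 hx, hpos x hx]

lemma hasGroupDeriv_test {φ : ℝ → ℝ} (hφ : ContDiff ℝ ∞ φ) (hc : HasCompactSupport φ) :
    HasGroupDeriv shift ((hφ.continuous.memLp_of_hasCompactSupport hc).toLp φ)
      (((hφ.continuous_deriv (by norm_num)).memLp_of_hasCompactSupport hc.deriv).toLp
        (deriv φ)) := by
  have hd := hφ.continuous_deriv (by norm_num)
  refine hasGroupDeriv_shift_iff.2 ⟨φ 0, ?_⟩
  filter_upwards [(hφ.continuous.memLp_of_hasCompactSupport (μ := volume) (p := 2) hc).coeFn_toLp]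
    with x hx
  have h1 := (hd.memLp_of_hasCompactSupport (μ := volume) (p := 2) hc.deriv).coeFn_toLp
  rw [hx, intervalIntegral.integral_congr_ae (h1.mono fun y hy _ => hy),
    intervalIntegral.integral_deriv_eq_sub (fun y _ => hφ.differentiable (by norm_num) y)
      (hd.intervalIntegrable _ _)]
  ring

/-- Test functions are differentiable vectors of the translation group, so antisymmetry of its
generator against them is the definition of the weak derivative. -/
lemma HasGroupDeriv.hasWeakDeriv_restr {a b : LineL2} (h : HasGroupDeriv shift a b) :
    HasWeakDeriv (restr a) (restr b) := by
  intro φ hφ hc hs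
  have h1 := isIsometryGroup_shift.inner_hasGroupDeriv h (hasGroupDeriv_test hφ hc)
  have h2 : ∀ (f : LineL2) {ψ : ℝ → ℝ} (hψ : MemLp ψ 2 volume),
      inner ℝ f (hψ.toLp ψ) = ∫ x, f x * ψ x := by
    intro f ψ hψ
    rw [L2.inner_def]
    refine integral_congr_ae ?_
    filter_upwards [hψ.coeFn_toLp] with x hx
    rw [hx]
    simp [mul_comm]
  rw [h2, h2] at h1
  rw [integral_restr_mul hs, integral_restr_mul (tsupport_deriv_subset.trans hs), h1, neg_neg]

/-- A differentiable vector has a continuous representative. It inherits the parity at every point,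
in particular at `0`, where an odd function must vanish. -/
lemma HasGroupDeriv.hasTrace_restr {ε : ℝ} {a b : LineL2} (h : HasGroupDeriv shift a b)
    (ha : reflect a = ε • a) : ∃ c, HasTrace (restr a) c ∧ ε * c = c := by
  obtain ⟨c, hc⟩ := hasGroupDeriv_shift_iff.1 h
  set F : ℝ → ℝ := fun x => c + ∫ y in 0..x, b y with hF
  have hFc : Continuous F := continuous_const.add (continuous_primitive_coeFn b)
  have hF0 : F 0 = c := by simp [hF]
  refine ⟨c, ⟨F, hFc.continuousOn, hF0, (coeFn_restr a).trans (ae_restrict_of_ae hc)⟩, ?_⟩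
  have h1 : (fun x => F (-x)) =ᵐ[volume] fun x => ε * F x := by
    have h0 := coeFn_reflect a
    rw [ha] at h0
    filter_upwards [h0, Lp.coeFn_smul ε a, hc, ae_neg hc] with x e1 e2 e3 e4
    rw [← e4, ← e1, e2, Pi.smul_apply, smul_eq_mul, e3]
  have h2 := congrFun ((Continuous.ae_eq_iff_eq volume (by fun_prop) (by fun_prop)).1 h1) 0
  simpa [hF0] using h2.symm

/-- The derivative intertwines the two heat semigroups of the half-line. -/
lemma HasWeakDeriv.legHeat {ε c : ℝ} (hε : ε * ε = 1) {f g : LegL2} (h : HasWeakDeriv f g)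
    (ht : HasTrace f c) (hc : ε * c = c) (t : ℝ≥0) :
    HasWeakDeriv (legHeat ε t f) (legHeat (-ε) t g) ∧
      ∃ d, HasTrace (WalshSpider.legHeat ε t f) d ∧ ε * d = d := by
  have h1 := isIsometryGroup_shift.hasGroupDeriv_average
    (ProbabilityTheory.gaussianReal 0 (2 * t)) (h.hasGroupDeriv_extend hε ht hc)
  refine ⟨h1.hasWeakDeriv_restr, h1.hasTrace_restr (?_ : reflect (lineHeat t _) = ε • lineHeat t _)⟩
  rw [reflect_lineHeat, reflect_extend hε, map_smul]

/-- The boundary conditions on `f` and `g` are exactly those making the `ε`-extension of `f` twice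
differentiable along translations; the conclusion on the line is then restricted. -/
lemma HasWeakDeriv.hasGenerator {ε c d : ℝ} (hε : ε * ε = 1) {f g v : LegL2}
    (hf : HasWeakDeriv f g) (htf : HasTrace f c) (hc : ε * c = c)
    (hg : HasWeakDeriv g v) (htg : HasTrace g d) (hd : -ε * d = d) :
    HasGenerator (WalshSpider.legHeat ε) f v := by
  have h1 := hf.hasGroupDeriv_extend hε htf hc
  have h2 := hg.hasGroupDeriv_extend (by rw [neg_mul_neg, hε]) htg hd
  rw [neg_neg] at h2
  have h3 := (restr.continuous.tendsto _).comp (isIsometryGroup_shift.hasGenerator_heat h1 h2)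
  rw [restr_extend] at h3
  refine h3.congr fun r => ?_
  simp only [Function.comp_apply, map_smul, map_sub, restr_extend]
  rfl

/-- The equation `u - u'' = f` on the half-line, with the Neumann condition for `ε = 1` and the
Dirichlet condition for `ε = -1`. -/
lemma exists_leg_sub_eq {ε : ℝ} (hε : ε * ε = 1) (f : LegL2) : ∃ u g c d,
    HasWeakDeriv u g ∧ HasTrace u c ∧ ε * c = c ∧ HasWeakDeriv g (u - f) ∧ HasTrace g d ∧
      -ε * d = d := by
  obtain ⟨w, v, h1, h2, h3⟩ := isIsometryGroup_shift.exists_sub_eq (extend ε f)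
  obtain ⟨h4, h5⟩ := h3 reflect ε reflect_shift (reflect_extend hε f)
  rw [← neg_smul] at h5
  obtain ⟨c, hc, hc'⟩ := h1.hasTrace_restr h4
  obtain ⟨d, hd, hd'⟩ := h2.hasTrace_restr h5
  refine ⟨restr w, restr v, c, d, h1.hasWeakDeriv_restr, hc, hc', ?_, hd, hd'⟩
  have h6 := h2.hasWeakDeriv_restr
  rwa [map_sub, restr_extend] at h6

end HalfLineCalculus

/-! ### Mean and deviations on the spider: vertex conditions, semigroups and kernels -/

section Spider

variable {N : ℕ}

/-- The mean of the values on the legs. -/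
def mean : SpiderL2 N →L[ℝ] LegL2 :=
  (N : ℝ)⁻¹ • ∑ j, PiLp.proj 2 (fun _ : Fin N => LegL2) j

lemma mean_apply (f : SpiderL2 N) : mean f = (N : ℝ)⁻¹ • ∑ j, f j := by
  simp [mean]

/-- The operator that acts by `S` on the means, and by `T` on functions with mean `0`. -/
def glue (S T : LegL2 →L[ℝ] LegL2) : SpiderL2 N →L[ℝ] SpiderL2 N :=
  (PiLp.continuousLinearEquiv 2 ℝ (fun _ : Fin N => LegL2)).symm.toContinuousLinearMap.comp
    (ContinuousLinearMap.pi fun j =>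
      S.comp mean + T.comp (PiLp.proj 2 (fun _ : Fin N => LegL2) j - mean))

lemma glue_apply (S T : LegL2 →L[ℝ] LegL2) (f : SpiderL2 N) (j : Fin N) :
    glue S T f j = S (mean f) + T (f j - mean f) := rfl

variable (hN : (N : ℝ) ≠ 0)

include hN

lemma sum_sub_mean (f : SpiderL2 N) : ∑ j, (f j - mean f) = 0 := by
  rw [Finset.sum_sub_distrib, mean_apply, Finset.sum_const, Finset.card_univ, Fintype.card_fin,
    ← Nat.cast_smul_eq_nsmul ℝ, smul_smul, mul_inv_cancel₀ hN, one_smul, sub_self]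

lemma mean_eq_of_sum_eq_zero {f : SpiderL2 N} {m : LegL2} {r : Fin N → LegL2}
    (hf : ∀ j, f j = m + r j) (hr : ∑ j, r j = 0) : mean f = m := by
  rw [mean_apply, Finset.sum_congr rfl fun j _ => hf j, Finset.sum_add_distrib, hr, add_zero,
    Finset.sum_const, Finset.card_univ, Fintype.card_fin, ← Nat.cast_smul_eq_nsmul ℝ, smul_smul,
    inv_mul_cancel₀ hN, one_smul]

lemma mean_glue (S T : LegL2 →L[ℝ] LegL2) (f : SpiderL2 N) :
    mean (glue S T f) = S (mean f) :=
  mean_eq_of_sum_eq_zero hN (fun j => glue_apply S T f j) (by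
    rw [← map_sum, sum_sub_mean hN, map_zero])

lemma glue_sub_mean (S T : LegL2 →L[ℝ] LegL2) (f : SpiderL2 N) (j : Fin N) :
    glue S T f j - mean (glue S T f) = T (f j - mean f) := by
  rw [mean_glue hN, glue_apply, add_sub_cancel_left]

omit hN in
lemma sum_norm_add_sq (m : LegL2) {r : Fin N → LegL2} (hr : ∑ j, r j = 0) :
    ∑ j, ‖m + r j‖ ^ 2 = N * ‖m‖ ^ 2 + ∑ j, ‖r j‖ ^ 2 := by
  simp only [norm_add_sq_real, Finset.sum_add_distrib]
  rw [← Finset.mul_sum, ← inner_sum, hr]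
  simp

/-- Pythagoras: mean and deviations are orthogonal in `L²(X)`, both before and after applying the
operators, since `T` keeps the sum of the deviations zero. -/
lemma norm_glue_le {S T : LegL2 →L[ℝ] LegL2} (hS : ∀ u, ‖S u‖ ≤ ‖u‖) (hT : ∀ u, ‖T u‖ ≤ ‖u‖)
    (f : SpiderL2 N) : ‖glue S T f‖ ≤ ‖f‖ := by
  have h1 : ‖glue S T f‖ ^ 2 ≤ ‖f‖ ^ 2 := by
    rw [PiLp.norm_sq_eq_of_L2, PiLp.norm_sq_eq_of_L2]
    have h2 : ∀ j, f j = mean f + (f j - mean f) := fun j => by abel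
    rw [Finset.sum_congr rfl fun j _ => congrArg (fun u : LegL2 => ‖u‖ ^ 2) (glue_apply S T f j),
      Finset.sum_congr rfl fun j _ => congrArg (fun u : LegL2 => ‖u‖ ^ 2) (h2 j),
      sum_norm_add_sq _ (by rw [← map_sum, sum_sub_mean hN, map_zero]),
      sum_norm_add_sq _ (sum_sub_mean hN f)]
    gcongr
    · exact hS _
    · exact hT _
  exact le_of_sq_le_sq h1 (norm_nonneg _)

lemma IsContractionSemigroup.glue {S T : ℝ≥0 → LegL2 →L[ℝ] LegL2}
    (hS : IsContractionSemigroup S) (hT : IsContractionSemigroup T) :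
    IsContractionSemigroup fun t => glue (N := N) (S t) (T t) where
  map_zero := by
    ext1 f
    ext1 j
    rw [glue_apply, hS.map_zero, hT.map_zero]
    simp
  map_add s t := by
    ext1 f
    ext1 j
    rw [ContinuousLinearMap.comp_apply, glue_apply, glue_apply, glue_sub_mean hN, mean_glue hN,
      hS.map_add, hT.map_add]
    simp
  continuous_apply f := by
    refine (PiLp.continuous_toLp 2 _).comp (continuous_pi fun j => ?_)
    exact (hS.continuous_apply _).add (hT.continuous_apply _)
  norm_le t f := norm_glue_le hN (hS.norm_le t) (hT.norm_le t) f

omit hN in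
lemma HasGenerator.glue {S T : ℝ≥0 → LegL2 →L[ℝ] LegL2} {u v : SpiderL2 N}
    (hS : HasGenerator S (mean u) (mean v))
    (hT : ∀ j, HasGenerator T (u j - mean u) (v j - mean v)) :
    HasGenerator (fun t => glue (S t) (T t)) u v := by
  have h1 : Tendsto (fun (h : ℝ≥0) (j : Fin N) => (h : ℝ)⁻¹ • (S h (mean u) - mean u) +
      (h : ℝ)⁻¹ • (T h (u j - mean u) - (u j - mean u))) (𝓝[>] 0) (𝓝 fun j => v j) := by
    refine tendsto_pi_nhds.2 fun j => ?_
    have := Tendsto.add hS (hT j)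
    rwa [add_sub_cancel] at this
  have h2 := ((PiLp.continuous_toLp 2 (fun _ : Fin N => LegL2)).tendsto _).comp h1
  refine h2.congr fun r => ?_
  ext1 j
  simp only [Function.comp_apply, PiLp.smul_apply, PiLp.sub_apply, glue_apply]
  rw [← smul_add]
  congr 1
  abel

omit hN in
lemma HasWeakDeriv.sub {f g f' g' : LegL2} (h : HasWeakDeriv f g) (h' : HasWeakDeriv f' g') :
    HasWeakDeriv (f - f') (g - g') := by
  have := h.add (h'.smul (-1))
  rwa [neg_one_smul, neg_one_smul, ← sub_eq_add_neg, ← sub_eq_add_neg] at this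

omit hN in
lemma HasTrace.sub {f f' : LegL2} {c c' : ℝ} (h : HasTrace f c) (h' : HasTrace f' c') :
    HasTrace (f - f') (c - c') := by
  have := h.add (h'.smul (-1))
  rwa [neg_one_smul, neg_one_mul, ← sub_eq_add_neg, ← sub_eq_add_neg] at this

omit hN in
lemma hasWeakDeriv_mean {f g : SpiderL2 N} (h : ∀ j, HasWeakDeriv (f j) (g j)) :
    HasWeakDeriv (mean f) (mean g) := by
  rw [mean_apply, mean_apply]
  refine HasWeakDeriv.smul _ ?_
  induction (Finset.univ : Finset (Fin N)) using Finset.induction_on with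
  | empty => simpa using hasWeakDeriv_zero
  | insert j s hj ih => rw [Finset.sum_insert hj, Finset.sum_insert hj]; exact (h j).add ih

omit hN in
lemma hasTrace_mean {f : SpiderL2 N} {c : Fin N → ℝ} (h : ∀ j, HasTrace (f j) (c j)) :
    HasTrace (mean f) ((N : ℝ)⁻¹ * ∑ j, c j) := by
  rw [mean_apply]
  refine HasTrace.smul _ ?_
  induction (Finset.univ : Finset (Fin N)) using Finset.induction_on with
  | empty => simpa using hasTrace_zero
  | insert j s hj ih => rw [Finset.sum_insert hj, Finset.sum_insert hj]; exact (h j).add ih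

omit hN in
/-- The vertex conditions: for `ε = 1`, the traces coincide, that is, functions of mean `0` have
traces `0`; for `ε = -1`, the sum of the traces is `0`, that is, the mean has trace `0`. -/
def VertexCondition (ε : ℝ) (f : SpiderL2 N) : Prop :=
  (∃ c, HasTrace (mean f) c ∧ ε * c = c) ∧ ∀ j, ∃ c, HasTrace (f j - mean f) c ∧ -ε * c = c

/-- The traces agree exactly when every deviation has trace `0`, which is the content of `-1 * c =
c`; the condition on the mean is only that a trace exists. -/
lemma mem_H10_iff {f : SpiderL2 N} : f ∈ H10 N ↔ f ∈ H1 N ∧ VertexCondition 1 f := by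
  refine and_congr_right fun _ => ⟨?_, ?_⟩
  · rintro ⟨c, hc⟩
    have h1 := hasTrace_mean hc
    have h2 : (N : ℝ)⁻¹ * ∑ _j : Fin N, c = c := by simp [hN]
    rw [h2] at h1
    exact ⟨⟨c, h1, one_mul c⟩, fun j => ⟨0, by simpa using (hc j).sub h1, by simp⟩⟩
  · rintro ⟨⟨c, hc, -⟩, h⟩
    refine ⟨c, fun j => ?_⟩
    obtain ⟨d, hd, hd'⟩ := h j
    obtain rfl : d = 0 := by linarith
    simpa using hc.add hd

lemma mem_H11_iff {f : SpiderL2 N} : f ∈ H11 N ↔ f ∈ H1 N ∧ VertexCondition (-1) f := by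
  refine and_congr_right fun _ => ⟨?_, ?_⟩
  · rintro ⟨c, hc, hs⟩
    have h1 := hasTrace_mean hc
    rw [hs, mul_zero] at h1
    exact ⟨⟨0, h1, by simp⟩, fun j => ⟨c j, by simpa using (hc j).sub h1, by simp⟩⟩
  · rintro ⟨⟨c, hc, hc'⟩, h⟩
    obtain rfl : c = 0 := by linarith
    choose d hd _ using h
    have h2 : ∀ j, HasTrace (f j) (d j) := fun j => by simpa using hc.add (hd j)
    refine ⟨d, h2, ?_⟩
    have h3 := (hasTrace_mean h2).unique hc
    simpa [hN] using h3

omit hN in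
lemma deriv'_eq {f g : SpiderL2 N} (h : ∀ j, HasWeakDeriv (f j) (g j)) : deriv' f = g := by
  ext1 j
  exact (h j).weakDeriv_eq

omit hN in
lemma hasWeakDeriv_deriv' {f : SpiderL2 N} (hf : f ∈ H1 N) (j : Fin N) :
    HasWeakDeriv (f j) (deriv' f j) := by
  obtain ⟨g, hg⟩ := hf j
  have : deriv' f j = g := hg.weakDeriv_eq
  rwa [this]

omit hN in
lemma mem_graph_secondDeriv {V W : Submodule ℝ (SpiderL2 N)} (hV : V ≤ H1 N) (hW : W ≤ H1 N)
    {u v : SpiderL2 N} : (u, v) ∈ (secondDeriv N V W hV hW).graph ↔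
      ∃ g, (∀ j, HasWeakDeriv (u j) (g j)) ∧ (∀ j, HasWeakDeriv (g j) (v j)) ∧ u ∈ V ∧ g ∈ W := by
  rw [LinearPMap.mem_graph_iff]
  constructor
  · rintro ⟨y, rfl, rfl⟩
    exact ⟨deriv' y, hasWeakDeriv_deriv' (hV y.2.1), hasWeakDeriv_deriv' (hW y.2.2), y.2.1, y.2.2⟩
  · rintro ⟨g, h1, h2, h3, h4⟩
    obtain rfl := deriv'_eq h1
    exact ⟨⟨u, h3, h4⟩, rfl, deriv'_eq h2⟩

/-- The graph of the operator `f ↦ f''` with the vertex condition `ε` for `f` and `-ε` for `f'`. -/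
def HasSecondDeriv (ε : ℝ) (u v : SpiderL2 N) : Prop :=
  ∃ g : SpiderL2 N, (∀ j, HasWeakDeriv (u j) (g j)) ∧ (∀ j, HasWeakDeriv (g j) (v j)) ∧
    VertexCondition ε u ∧ VertexCondition (-ε) g

omit hN in
lemma mem_H1 {f g : SpiderL2 N} (h : ∀ j, HasWeakDeriv (f j) (g j)) : f ∈ H1 N :=
  fun j => ⟨g j, h j⟩

lemma mem_graph_laplacian {u v : SpiderL2 N} :
    (u, v) ∈ (laplacian N).graph ↔ HasSecondDeriv 1 u v := by
  rw [laplacian, mem_graph_secondDeriv]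
  refine exists_congr fun g => and_congr_right fun h1 => and_congr_right fun h2 => ?_
  rw [mem_H10_iff hN, mem_H11_iff hN, and_iff_right (mem_H1 h1), and_iff_right (mem_H1 h2)]

lemma mem_graph_formLaplacian {u v : SpiderL2 N} :
    (u, v) ∈ (formLaplacian N).graph ↔ HasSecondDeriv (-1) u v := by
  rw [formLaplacian, mem_graph_secondDeriv]
  refine exists_congr fun g => and_congr_right fun h1 => and_congr_right fun h2 => ?_
  rw [mem_H10_iff hN, mem_H11_iff hN, and_iff_right (mem_H1 h1), and_iff_right (mem_H1 h2), neg_neg]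

omit hN in
/-- The heat semigroup of the spider, with Kirchhoff conditions for `ε = 1` and anti-Kirchhoff
conditions for `ε = -1`. -/
def spiderHeat (N : ℕ) (ε : ℝ) (t : ℝ≥0) : SpiderL2 N →L[ℝ] SpiderL2 N :=
  glue (legHeat ε t) (legHeat (-ε) t)

lemma isContractionSemigroup_spiderHeat {ε : ℝ} (hε : ε * ε = 1) :
    IsContractionSemigroup (spiderHeat N ε) :=
  (isContractionSemigroup_legHeat hε).glue hN
    (isContractionSemigroup_legHeat (by rw [neg_mul_neg, hε]))

omit hN in
lemma HasSecondDeriv.hasGenerator {ε : ℝ} (hε : ε * ε = 1) {u v : SpiderL2 N}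
    (h : HasSecondDeriv ε u v) : HasGenerator (spiderHeat N ε) u v := by
  obtain ⟨g, h1, h2, ⟨⟨c, hc, hc'⟩, h3⟩, ⟨d, hd, hd'⟩, h4⟩ := h
  have m1 := hasWeakDeriv_mean h1
  have m2 := hasWeakDeriv_mean h2
  refine HasGenerator.glue (m1.hasGenerator hε hc hc' m2 hd hd') fun j => ?_
  obtain ⟨c, hc, hc'⟩ := h3 j
  obtain ⟨d, hd, hd'⟩ := h4 j
  exact ((h1 j).sub m1).hasGenerator (by rw [neg_mul_neg, hε]) hc hc' ((h2 j).sub m2) hd hd'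

/-- The equation is solved separately for the mean (sign `ε`) and for each deviation (sign `-ε`).
The solutions `U j` are chosen leg by leg, so their sum is not known to vanish; subtracting their
mean `mean p` restores this. It does not disturb the equation, as the right-hand sides `f j - mean
f` sum to zero, nor the traces, as the trace conditions are linear. -/
lemma exists_hasSecondDeriv {ε : ℝ} (hε : ε * ε = 1) (f : SpiderL2 N) :
    ∃ u v, HasSecondDeriv ε u v ∧ u - v = f := by
  obtain ⟨u, g, c, d, hu, hc, hc', hg, hd, hd'⟩ := exists_leg_sub_eq hε (mean f)
  have h := fun j => exists_leg_sub_eq (ε := -ε) (by rw [neg_mul_neg, hε]) (f j - mean f)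
  choose U G C D hU hC hC' hG hD hD' using h
  set p : SpiderL2 N := WithLp.toLp 2 U with hp
  set q : SpiderL2 N := WithLp.toLp 2 G with hq
  have hpq : HasWeakDeriv (mean p) (mean q) := hasWeakDeriv_mean fun j => hU j
  set z : SpiderL2 N := WithLp.toLp 2 fun j => U j - (f j - mean f) with hz
  have hqz : HasWeakDeriv (mean q) (mean z) := hasWeakDeriv_mean fun j => hG j
  have hzp : mean z = mean p := by
    rw [mean_apply, mean_apply, hz, hp]
    congr 1
    change ∑ j, (U j - (f j - mean f)) = ∑ j, U j
    rw [Finset.sum_sub_distrib, sum_sub_mean hN, sub_zero]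
  rw [hzp] at hqz
  have tp := hasTrace_mean (f := p) fun j => hC j
  have tq := hasTrace_mean (f := q) fun j => hD j
  have hsum : ∀ (a : ℝ) (c : Fin N → ℝ), (∀ j, a * c j = c j) →
      a * ((N : ℝ)⁻¹ * ∑ j, c j) = (N : ℝ)⁻¹ * ∑ j, c j := by
    intro a c h
    rw [mul_left_comm, Finset.mul_sum, Finset.sum_congr rfl fun j _ => h j]
  have e1 := hsum _ _ hC'
  have e2 := hsum _ _ hD'
  have m1 : mean (WithLp.toLp 2 fun j => u + (U j - mean p) : SpiderL2 N) = u :=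
    mean_eq_of_sum_eq_zero hN (r := fun j => p j - mean p) (fun j => rfl) (sum_sub_mean hN p)
  have m2 : mean (WithLp.toLp 2 fun j => g + (G j - mean q) : SpiderL2 N) = g :=
    mean_eq_of_sum_eq_zero hN (r := fun j => q j - mean q) (fun j => rfl) (sum_sub_mean hN q)
  refine ⟨WithLp.toLp 2 fun j => u + (U j - mean p),
    WithLp.toLp 2 fun j => (u - mean f) + ((U j - (f j - mean f)) - mean p),
    ⟨WithLp.toLp 2 fun j => g + (G j - mean q), fun j => hu.add ((hU j).sub hpq),
      fun j => hg.add ((hG j).sub hqz), ⟨⟨c, by rwa [m1], hc'⟩, fun j => ?_⟩,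
      ⟨d, by rwa [m2], hd'⟩, fun j => ?_⟩, ?_⟩
  · rw [m1]
    refine ⟨_, ?_, (by rw [mul_sub, hC', e1] : -ε * (C j - (N : ℝ)⁻¹ * ∑ j, C j) = _)⟩
    simpa using (hC j).sub tp
  · rw [m2]
    refine ⟨_, ?_, (by rw [mul_sub, hD', e2] : - -ε * (D j - (N : ℝ)⁻¹ * ∑ j, D j) = _)⟩
    simpa using (hD j).sub tq
  · ext1 j
    simp only [PiLp.sub_apply]
    abel

/-- The derivative intertwines the two heat semigroups of the spider. -/
lemma hasWeakDeriv_spiderHeat {ε : ℝ} (hε : ε * ε = 1) {f g : SpiderL2 N}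
    (h : ∀ j, HasWeakDeriv (f j) (g j)) (hf : VertexCondition ε f) (t : ℝ≥0) :
    (∀ j, HasWeakDeriv (spiderHeat N ε t f j) (spiderHeat N (-ε) t g j)) ∧
      VertexCondition ε (spiderHeat N ε t f) := by
  obtain ⟨⟨c, hc, hc'⟩, h1⟩ := hf
  choose d hd hd' using h1
  have m := (hasWeakDeriv_mean h).legHeat hε hc hc' t
  have r := fun j => ((h j).sub (hasWeakDeriv_mean h)).legHeat (by rw [neg_mul_neg, hε])
    (hd j) (hd' j) t
  refine ⟨fun j => m.1.add (r j).1, ?_, fun j => ?_⟩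
  · rw [spiderHeat, mean_glue hN]
    exact m.2
  · rw [spiderHeat, glue_sub_mean hN]
    exact (r j).2

omit hN in
/-- The kernel of `spiderHeat N ε`. -/
def spiderKernel (N : ℕ) (ε t : ℝ) (i : Fin N) (x : ℝ) (j : Fin N) (y : ℝ) : ℝ :=
  (if i = j then gauss t (x - y) + -ε * gauss t (x + y) else 0) +
    2 * ε / (N : ℝ) * gauss t (x + y)

omit hN in
lemma heatKernel_eq (t : ℝ) : heatKernel N t = spiderKernel N 1 t := by
  funext i x j y
  rw [heatKernel, spiderKernel]
  split_ifs <;> ring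

omit hN in
lemma formHeatKernel_eq (t : ℝ) : formHeatKernel N t = spiderKernel N (-1) t := by
  funext i x j y
  rw [formHeatKernel, spiderKernel]
  split_ifs <;> ring

omit hN in
lemma coeFn_sum {ι : Type*} (s : Finset ι) (u : ι → LegL2) :
    (∑ j ∈ s, u j : LegL2) =ᵐ[legMeasure] fun x => ∑ j ∈ s, u j x := by
  classical
  induction s using Finset.induction_on with
  | empty => simp only [Finset.sum_empty]; exact Lp.coeFn_zero ℝ 2 legMeasure
  | insert j s hj ih =>
    rw [Finset.sum_insert hj]
    filter_upwards [Lp.coeFn_add (u j) (∑ j ∈ s, u j), ih] with x h1 h2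
    rw [h1, Pi.add_apply, h2, Finset.sum_insert hj]

omit hN in
lemma hasKernel_spiderHeat {ε : ℝ} {t : ℝ≥0} (ht : 0 < t) :
    HasKernel (spiderHeat N ε t) (spiderKernel N ε t) := by
  intro f i
  have h1 : ∀ᵐ x ∂legMeasure, ∀ j, _ := ae_all_iff.2 fun j => coeFn_legHeat ε ht (f j)
  have h2 : ∀ᵐ x ∂legMeasure, ∀ j, _ := ae_all_iff.2 fun j => coeFn_legHeat (-ε) ht (f j)
  -- Regrouped by legs, the glued operator is one half-line flow on leg `i` plus `1/N` times a sum
  -- of differences of the two flows. The kernel of each difference is `2 ε g_t(x + y)`, whence the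
  -- coefficient `2ε/N`.
  have h3 : spiderHeat N ε t f i = legHeat (-ε) t (f i) +
      (N : ℝ)⁻¹ • ∑ j, (legHeat ε t (f j) - legHeat (-ε) t (f j)) := by
    rw [spiderHeat, glue_apply, mean_apply, map_sub, map_smul, map_smul, map_sum, map_sum,
      Finset.sum_sub_distrib, smul_sub]
    abel
  have h4 : ∀ᵐ x ∂legMeasure, ∀ j, (legHeat ε t (f j) - legHeat (-ε) t (f j)) x =
      legHeat ε t (f j) x - legHeat (-ε) t (f j) x := ae_all_iff.2 fun j => Lp.coeFn_sub _ _
  filter_upwards [h1, h2, Lp.coeFn_add (legHeat (-ε) t (f i))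
    ((N : ℝ)⁻¹ • ∑ j, (legHeat ε t (f j) - legHeat (-ε) t (f j))),
    Lp.coeFn_smul (N : ℝ)⁻¹ (∑ j, (legHeat ε t (f j) - legHeat (-ε) t (f j))),
    coeFn_sum Finset.univ fun j => (legHeat ε t (f j) - legHeat (-ε) t (f j)), h4]
    with x e1 e2 e3 e4 e5 e6
  have hsplit : ∀ j, (fun y => spiderKernel N ε t i x j y * f j y) = fun y =>
      (if i = j then 1 else 0) * ((gauss t (x - y) + -ε * gauss t (x + y)) * f j y) +
      (N : ℝ)⁻¹ * ((gauss t (x - y) + ε * gauss t (x + y)) * f j y -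
        (gauss t (x - y) + -ε * gauss t (x + y)) * f j y) := by
    intro j
    funext y
    rw [spiderKernel]
    split_ifs <;> ring
  have i1 := fun j => (e2 j).1.const_mul (if i = j then 1 else 0)
  have i2 := fun j => ((e1 j).1.sub (e2 j).1).const_mul (N : ℝ)⁻¹
  constructor
  · intro j
    rw [hsplit]
    exact (i1 j).add (i2 j)
  · rw [h3, e3, Pi.add_apply, e4, Pi.smul_apply, e5]
    have e7 : ∀ j, ∫ y in Ioi 0, spiderKernel N ε t i x j y * f j y =
        (if i = j then 1 else 0) * legHeat (-ε) t (f j) x +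
          (N : ℝ)⁻¹ * (legHeat ε t (f j) x - legHeat (-ε) t (f j) x) := by
      intro j
      have i3 := i2 j
      simp only [Pi.sub_apply] at i3
      rw [hsplit, integral_add (i1 j) i3, integral_const_mul, integral_const_mul,
        integral_sub (e1 j).1 (e2 j).1, ← (e1 j).2, ← (e2 j).2]
    rw [Finset.sum_congr rfl fun j _ => e7 j, Finset.sum_add_distrib, ← Finset.mul_sum]
    simp only [ite_mul, one_mul, zero_mul, Finset.sum_ite_eq, Finset.mem_univ, if_true, e6,
      smul_eq_mul]

end Spider

/-! ### Domination of kernels and operators, and optimality of the constant -/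

section Domination

variable {N : ℕ}

lemma continuous_gauss (t : ℝ) : Continuous (gauss t) := by
  unfold gauss
  fun_prop

lemma gauss_pos {t : ℝ} (ht : 0 < t) (u : ℝ) : 0 < gauss t u := by
  unfold gauss
  positivity

lemma gauss_add_le_gauss_sub {t x y : ℝ} (ht : 0 < t) (hx : 0 ≤ x) (hy : 0 ≤ y) :
    gauss t (x + y) ≤ gauss t (x - y) := by
  unfold gauss
  have : (x - y) ^ 2 ≤ (x + y) ^ 2 := by nlinarith [mul_nonneg hx hy]
  gcongr

/-- On different legs the two kernels agree up to sign. On one leg, `(N - 1) p_t - \vec p_t` equals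
`(N - 2)(g_t(x-y) - g_t(x+y))`. -/
lemma abs_formHeatKernel_le (hN : 2 ≤ N) {t : ℝ} (ht : 0 < t) (j k : Fin N) {x y : ℝ}
    (hx : 0 ≤ x) (hy : 0 ≤ y) :
    |formHeatKernel N t j x k y| ≤ ((N : ℝ) - 1) * heatKernel N t j x k y := by
  have hN' : (2 : ℝ) ≤ N := by exact_mod_cast hN
  have h1 := gauss_pos ht (x + y)
  have h2 := gauss_pos ht (x - y)
  have h3 := gauss_add_le_gauss_sub ht hx hy
  have h4 : 0 ≤ 1 - 2 / (N : ℝ) := by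
    rw [sub_nonneg, div_le_one (by linarith)]
    exact hN'
  rw [formHeatKernel, heatKernel]
  split_ifs with h
  · rw [abs_of_nonneg (by positivity)]
    have h5 : ((N : ℝ) - 1) * (gauss t (x - y) - (1 - 2 / (N : ℝ)) * gauss t (x + y)) -
        (gauss t (x - y) + (1 - 2 / (N : ℝ)) * gauss t (x + y)) =
        ((N : ℝ) - 2) * (gauss t (x - y) - gauss t (x + y)) := by
      field_simp
      ring
    have h6 : 0 ≤ ((N : ℝ) - 2) * (gauss t (x - y) - gauss t (x + y)) :=
      mul_nonneg (by linarith) (by linarith)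
    linarith
  · rw [abs_neg, abs_of_nonneg (by positivity)]
    exact le_mul_of_one_le_left (by positivity) (by linarith)

lemma continuous_spiderKernel (ε t : ℝ) (i j : Fin N) :
    Continuous fun z : ℝ × ℝ => spiderKernel N ε t i z.1 j z.2 := by
  unfold spiderKernel
  have := continuous_gauss t
  split_ifs <;> fun_prop

/-- The best constant, from an inequality between the kernels at the vertex. -/
lemma sub_one_le_of_kernel_zero (hN : 2 ≤ N) {t C : ℝ} (ht : 0 < t) {i : Fin N}
    (h : spiderKernel N (-1) t i 0 i 0 ≤ C * spiderKernel N 1 t i 0 i 0) : (N : ℝ) - 1 ≤ C := by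
  have hN' : (2 : ℝ) ≤ N := by exact_mod_cast hN
  have h0 := gauss_pos ht 0
  simp only [spiderKernel, if_true, sub_zero, add_zero] at h
  -- At the vertex the kernels are `(2/N) g_t(0)` and `(2 - 2/N) g_t(0) = (N - 1)(2/N) g_t(0)`.
  have e1 : C * (gauss t 0 + -1 * gauss t 0 + 2 * 1 / (N : ℝ) * gauss t 0) -
      (gauss t 0 + - -1 * gauss t 0 + 2 * -1 / (N : ℝ) * gauss t 0) =
      (C - (N - 1)) * (2 / N * gauss t 0) := by
    field_simp
    ring
  have h2 : 0 ≤ (C - (N - 1)) * (2 / N * gauss t 0) := by linarith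
  have h3 : 0 ≤ C - (N - 1) := nonneg_of_mul_nonneg_left h2 (by positivity)
  linarith

lemma coeFn_absL2 (f : SpiderL2 N) (j : Fin N) :
    absL2 f j =ᵐ[legMeasure] fun x => |f j x| := Lp.coeFn_abs (f j)

/-- Domination of kernels implies domination of operators. -/
lemma HasKernel.leAE {K P : SpiderL2 N →L[ℝ] SpiderL2 N} {k p : Fin N → ℝ → Fin N → ℝ → ℝ}
    (hK : HasKernel K k) (hP : HasKernel P p) {C : ℝ}
    (h : ∀ i j x y, 0 ≤ x → 0 ≤ y → |k i x j y| ≤ C * p i x j y) (f : SpiderL2 N) :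
    LeAE (absL2 (K f)) (C • P (absL2 f)) := by
  intro i
  filter_upwards [hK f i, hP (absL2 f) i, coeFn_absL2 (K f) i, Lp.coeFn_smul C (P (absL2 f) i),
    self_mem_ae_restrict measurableSet_Ioi] with x h1 h2 h3 h4 hx
  rw [h3, h1.2]
  have h5 : (C • P (absL2 f)) i x = C * P (absL2 f) i x := h4
  rw [h5, h2.2, Finset.mul_sum]
  refine (Finset.abs_sum_le_sum_abs _ _).trans (Finset.sum_le_sum fun j _ => ?_)
  rw [← integral_const_mul]
  refine (abs_integral_le_integral_abs).trans
    (integral_mono_ae (h1.1 j).abs ((h2.1 j).const_mul C) ?_)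
  filter_upwards [coeFn_absL2 f j, self_mem_ae_restrict measurableSet_Ioi] with y e1 hy
  rw [e1, abs_mul, ← mul_assoc]
  exact mul_le_mul_of_nonneg_right (h i j x y (le_of_lt hx) (le_of_lt hy)) (abs_nonneg _)

/-- Domination of operators implies domination of kernels, here on the diagonal of a leg at the
vertex. -/
lemma HasKernel.le_of_leAE {K P : SpiderL2 N →L[ℝ] SpiderL2 N} {k p : Fin N → ℝ → Fin N → ℝ → ℝ}
    (hK : HasKernel K k) (hP : HasKernel P p) {C : ℝ}
    (h : ∀ f, LeAE (absL2 (K f)) (C • P (absL2 f))) (i : Fin N)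
    (hk : Continuous fun z : ℝ × ℝ => k i z.1 i z.2)
    (hp : Continuous fun z : ℝ × ℝ => p i z.1 i z.2) : k i 0 i 0 ≤ C * p i 0 i 0 := by
  by_contra! hlt
  -- If the inequality fails at the vertex, continuity makes it fail by at least `η` on a box `(0,
  -- δ)²`. The indicator of `(0, δ)` on leg `i` equals its absolute value, and testing with it at
  -- some `x` in `(0, δ)` gives `η δ ≤ 0`.
  obtain ⟨η, hη0, hη⟩ : ∃ η, 0 < η ∧ η < k i 0 i 0 - C * p i 0 i 0 := exists_between (by linarith)
  have hc : Continuous fun z : ℝ × ℝ => k i z.1 i z.2 - C * p i z.1 i z.2 := by fun_prop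
  obtain ⟨δ, hδ, hball⟩ := Metric.eventually_nhds_iff.1
    ((hc.tendsto (0, 0)).eventually_const_lt hη)
  have hbox : ∀ x y, x ∈ Ioo 0 δ → y ∈ Ioo 0 δ → η < k i x i y - C * p i x i y := by
    intro x y hx hy
    refine @hball (x, y) ?_
    rw [Prod.dist_eq, max_lt_iff, Real.dist_0_eq_abs, Real.dist_0_eq_abs, abs_of_pos hx.1,
      abs_of_pos hy.1]
    exact ⟨hx.2, hy.2⟩
  have hfin : legMeasure (Ioo 0 δ) ≠ ⊤ :=
    ((Measure.restrict_apply_le _ _).trans_lt (by simp)).ne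
  set u : LegL2 := indicatorConstLp 2 measurableSet_Ioo hfin (1 : ℝ) with hu
  have hu' : u =ᵐ[legMeasure] (Ioo 0 δ).indicator fun _ => (1 : ℝ) := indicatorConstLp_coeFn
  set f : SpiderL2 N := WithLp.toLp 2 (Pi.single i u) with hf
  have hfi : f i = u := by simp [hf]
  have hfj : ∀ j, j ≠ i → f j = 0 := fun j hj => by simp [hf, hj]
  have habs : absL2 f = f := by
    ext1 j
    refine Lp.ext ((coeFn_absL2 f j).trans ?_)
    rcases eq_or_ne j i with rfl | hj
    · rw [hfi]
      filter_upwards [hu'] with x hx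
      rw [hx, abs_of_nonneg (indicator_nonneg (fun _ _ => zero_le_one) x)]
    · rw [hfj j hj]
      filter_upwards [Lp.coeFn_zero ℝ 2 legMeasure] with x hx
      rw [hx]
      simp
  have hsum : ∀ (q : Fin N → ℝ → Fin N → ℝ → ℝ) x,
      ∑ j, ∫ y in Ioi 0, q i x j y * f j y = ∫ y in Ioi 0, q i x i y * u y := by
    intro q x
    rw [Finset.sum_eq_single i _ (by simp), hfi]
    intro j _ hj
    refine integral_eq_zero_of_ae ?_
    rw [hfj j hj]
    filter_upwards [Lp.coeFn_zero ℝ 2 legMeasure] with y hy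
    rw [hy]
    simp
  have hne : (ae (legMeasure.restrict (Ioo 0 δ))).NeBot := by
    rw [ae_neBot, Ne, Measure.restrict_eq_zero, Measure.restrict_apply measurableSet_Ioo,
      inter_eq_left.2 Ioo_subset_Ioi_self]
    simp [hδ]
  have hall := h f i
  rw [habs] at hall
  obtain ⟨x, ⟨⟨e1, e2, e3, e4, e5⟩, hx⟩⟩ := ((ae_restrict_of_ae (s := Ioo 0 δ)
    (hall.and ((hK f i).and ((hP f i).and ((coeFn_absL2 (K f) i).and
      (Lp.coeFn_smul C (P f i))))))).and (self_mem_ae_restrict measurableSet_Ioo)).exists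
  have e6 : (C • P f) i x = C * P f i x := e5
  have e7 : absL2 (K f) i x = |K f i x| := e4
  rw [e7, e6, e2.2, e3.2, hsum, hsum] at e1
  have i1 := e2.1 i
  have i2 := (e3.1 i).const_mul C
  rw [hfi] at i1 i2
  have h7 : ∫ y in Ioi 0, (k i x i y * u y - C * (p i x i y * u y)) ≤ 0 := by
    rw [integral_sub i1 i2, integral_const_mul]
    linarith [le_abs_self (∫ y in Ioi 0, k i x i y * u y)]
  have h8 : ∫ y in Ioi 0, η * u y ≤ ∫ y in Ioi 0, (k i x i y * u y - C * (p i x i y * u y)) := by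
    refine integral_mono_ae ?_ (i1.sub i2) ?_
    · exact (integrable_indicatorConstLp measurableSet_Ioo hfin 1).const_mul η
    · filter_upwards [hu'] with y hy
      rw [hy]
      by_cases hy' : y ∈ Ioo 0 δ
      · have := hbox x y hx hy'
        simp only [indicator_of_mem hy', mul_one]
        linarith
      · simp [indicator_of_notMem hy']
  rw [integral_const_mul, integral_congr_ae hu', integral_indicator_const _ measurableSet_Ioo,
    measureReal_restrict_apply measurableSet_Ioo, inter_eq_left.2 Ioo_subset_Ioi_self,
    Real.volume_real_Ioo_of_le hδ.le, sub_zero, smul_eq_mul, mul_one] at h8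
  have := mul_pos hη0 hδ
  linarith

lemma sqrtCarre_eq (f : SpiderL2 N) : sqrtCarre f = absL2 (deriv' f) := by
  ext1 j
  refine Lp.ext ?_
  filter_upwards [(memLp_sqrt_carre f j).coeFn_toLp, coeFn_absL2 (deriv' f) j] with x h1 h2
  rw [h2]
  exact h1.trans (by rw [carre, Real.sqrt_mul_self_eq_abs])

lemma leAE_iff {f g : SpiderL2 N} : LeAE f g ↔ ∀ j, f j ≤ g j :=
  forall_congr' fun j => Lp.coeFn_le (f j) (g j)

lemma continuous_leg (j : Fin N) : Continuous fun f : SpiderL2 N => f j :=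
  (PiLp.proj (𝕜 := ℝ) 2 (fun _ : Fin N => LegL2) j).continuous

lemma continuous_absL2 : Continuous (absL2 : SpiderL2 N → SpiderL2 N) := by
  refine (PiLp.continuous_toLp 2 _).comp (continuous_pi fun j => ?_)
  exact (continuous_leg j).sup (continuous_leg j).neg

/-- The order of `L²` is closed. This lets an inequality known on a dense set of functions extend to
all of `L²(X)`. -/
lemma isClosed_leAE {F G : SpiderL2 N → SpiderL2 N} (hF : Continuous F) (hG : Continuous G) :
    IsClosed {f | LeAE (F f) (G f)} := by
  simp only [leAE_iff, ofPred_forall]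
  refine isClosed_iInter fun j => ?_
  exact isClosed_le ((continuous_leg j).comp hF) ((continuous_leg j).comp hG)

/-- Such a function is constant, and `(0, ∞)` has infinite measure, so the only constant in `L²` is
`0`. -/
lemma HasWeakDeriv.eq_zero {f : LegL2} (h : HasWeakDeriv f 0) : f = 0 := by
  obtain ⟨c, -, hc⟩ := h.exists_eq_integral
  have h1 : f =ᵐ[legMeasure] fun _ => c := by
    filter_upwards [hc] with x hx
    rw [hx, map_zero, intervalIntegral.integral_congr_ae
      ((Lp.coeFn_zero ℝ 2 (volume : Measure ℝ)).mono fun y hy _ => hy)]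
    simp
  have h2 : MemLp (fun _ : ℝ => c) 2 legMeasure := (memLp_congr_ae h1).1 (Lp.memLp f)
  rw [memLp_const_iff (by norm_num) (by norm_num)] at h2
  have h3 : c = 0 := h2.resolve_right (by simp)
  refine Lp.ext (h1.trans ?_)
  rw [h3]
  exact (Lp.coeFn_zero ℝ 2 legMeasure).symm

/-- The derivatives of the functions in `H¹₀(X)` are dense in `L²(X)`. -/
lemma dense_deriv'_H10 : Dense (deriv' '' (H10 N : Set (SpiderL2 N))) := by
  let D : Submodule ℝ (SpiderL2 N) :=
    { carrier := deriv' '' (H10 N : Set (SpiderL2 N))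
      zero_mem' := ⟨0, (H10 N).zero_mem, deriv'_zero⟩
      add_mem' := by
        rintro _ _ ⟨f, hf, rfl⟩ ⟨g, hg, rfl⟩
        exact ⟨f + g, (H10 N).add_mem hf hg, deriv'_add hf.1 hg.1⟩
      smul_mem' := by
        rintro a _ ⟨f, hf, rfl⟩
        exact ⟨a • f, (H10 N).smul_mem a hf, deriv'_smul a hf.1⟩ }
  change Dense (D : Set (SpiderL2 N))
  rw [Submodule.dense_iff_topologicalClosure_eq_top, Submodule.topologicalClosure_eq_top_iff,
    Submodule.eq_bot_iff]
  intro z hz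
  ext1 j
  -- A test function placed on leg `j` and extended by `0` to the other legs belongs to `H¹₀(X)`.
  -- Orthogonality of `z` to its derivative says that `z j` has weak derivative zero.
  refine HasWeakDeriv.eq_zero fun φ hφ hc hs => ?_
  have hd := hasGroupDeriv_test hφ hc
  set a : LineL2 := (hφ.continuous.memLp_of_hasCompactSupport hc).toLp φ with ha
  have hb' := ((hφ.continuous_deriv (by norm_num)).memLp_of_hasCompactSupport
    (μ := volume) (p := 2) hc.deriv).coeFn_toLp
  set b : LineL2 := ((hφ.continuous_deriv (by norm_num)).memLp_of_hasCompactSupport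
    hc.deriv).toLp (deriv φ) with hb
  have hw : ∀ k, HasWeakDeriv ((WithLp.toLp 2 (Pi.single j (restr a)) : SpiderL2 N) k)
      ((WithLp.toLp 2 (Pi.single j (restr b)) : SpiderL2 N) k) := by
    intro k
    rcases eq_or_ne k j with rfl | hk
    · simpa using hd.hasWeakDeriv_restr
    · simpa [hk] using hasWeakDeriv_zero
  have ht : HasTrace (restr a) 0 := by
    refine ⟨φ, hφ.continuous.continuousOn, ?_, (coeFn_restr a).trans (ae_restrict_of_ae
      (hφ.continuous.memLp_of_hasCompactSupport hc).coeFn_toLp)⟩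
    exact image_eq_zero_of_notMem_tsupport fun h => lt_irrefl (0 : ℝ) (hs h)
  have hmem : (WithLp.toLp 2 (Pi.single j (restr a)) : SpiderL2 N) ∈ H10 N := by
    refine ⟨mem_H1 hw, 0, fun k => ?_⟩
    rcases eq_or_ne k j with rfl | hk
    · simpa using ht
    · simpa [hk] using hasTrace_zero
  have h1 : inner ℝ (WithLp.toLp 2 (Pi.single j (restr b)) : SpiderL2 N) z = 0 :=
    Submodule.inner_right_of_mem_orthogonal (K := D) ⟨_, hmem, deriv'_eq hw⟩ hz
  rw [PiLp.inner_apply, Finset.sum_eq_single j (fun k _ hk => by simp [hk]) (by simp)] at h1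
  simp only [Pi.single_eq_same] at h1
  rw [L2.inner_def] at h1
  have h2 : ∫ x in Ioi 0, (0 : LegL2) x * φ x = 0 := by
    refine integral_eq_zero_of_ae ?_
    filter_upwards [Lp.coeFn_zero ℝ 2 legMeasure] with x hx
    rw [hx]
    simp
  refine (integral_congr_ae ?_).trans (h1.trans (neg_eq_zero.2 h2).symm)
  filter_upwards [coeFn_restr b, ae_restrict_of_ae hb'] with x e1 e2
  rw [e1, hb, e2]
  simp

lemma sub_one_le_of_leAE (hN : 2 ≤ N) {t : ℝ≥0} (ht : 0 < t) {C : ℝ}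
    (h : ∀ f : SpiderL2 N,
      LeAE (absL2 (spiderHeat N (-1) t f)) (C • spiderHeat N 1 t (absL2 f))) : (N : ℝ) - 1 ≤ C :=
  sub_one_le_of_kernel_zero hN (t := t) (by exact_mod_cast ht) (i := ⟨0, by omega⟩)
    ((hasKernel_spiderHeat ht).le_of_leAE (hasKernel_spiderHeat ht) h _
      (continuous_spiderKernel _ _ _ _) (continuous_spiderKernel _ _ _ _))

lemma leAE_spiderHeat (hN : 2 ≤ N) (t : ℝ≥0) (f : SpiderL2 N) :
    LeAE (absL2 (spiderHeat N (-1) t f)) (((N : ℝ) - 1) • spiderHeat N 1 t (absL2 f)) := by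
  have hN0 : (N : ℝ) ≠ 0 := by positivity
  have hN' : (2 : ℝ) ≤ N := by exact_mod_cast hN
  -- At `t = 0` there is no kernel: both operators are the identity, and `N - 1 ≥ 1` suffices.
  rcases eq_or_ne t 0 with rfl | ht
  · rw [(isContractionSemigroup_spiderHeat hN0 (by norm_num)).map_zero,
      (isContractionSemigroup_spiderHeat hN0 (by norm_num)).map_zero]
    intro j
    filter_upwards [coeFn_absL2 f j, Lp.coeFn_smul ((N : ℝ) - 1) (absL2 f j)] with x h1 h2
    have h3 : (((N : ℝ) - 1) • absL2 f) j x = ((N : ℝ) - 1) * absL2 f j x := h2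
    change absL2 f j x ≤ (((N : ℝ) - 1) • absL2 f) j x
    rw [h3, h1]
    exact le_mul_of_one_le_left (abs_nonneg _) (by linarith)
  · have ht' : 0 < t := pos_iff_ne_zero.2 ht
    refine (hasKernel_spiderHeat ht').leAE (hasKernel_spiderHeat ht') (fun i j x y hx hy => ?_) f
    rw [← heatKernel_eq, ← formHeatKernel_eq]
    exact abs_formHeatKernel_le hN (by exact_mod_cast ht') i j hx hy

/-- The intertwining that reduces the gradient estimate for functions to the domination of the
semigroup on one-forms. -/
lemma deriv'_spiderHeat (hN : (N : ℝ) ≠ 0) (t : ℝ≥0) {f : SpiderL2 N} (hf : f ∈ H10 N) :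
    spiderHeat N 1 t f ∈ H10 N ∧
      deriv' (spiderHeat N 1 t f) = spiderHeat N (-1) t (deriv' f) := by
  rw [mem_H10_iff hN] at hf
  obtain ⟨h1, h2⟩ := hasWeakDeriv_spiderHeat hN (by norm_num) (hasWeakDeriv_deriv' hf.1) hf.2 t
  exact ⟨(mem_H10_iff hN).2 ⟨mem_H1 h1, h2⟩, deriv'_eq h1⟩

end Domination

end WalshSpider

end

/-! ### The theorem -/

theorem mainTheorem3 (N : ℕ) (hN : 2 ≤ N) :
    -- the semigroups generated by the two Laplacians exist and are unique
    (∃! P, WalshSpider.IsSemigroupOf (WalshSpider.laplacian N) P) ∧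
    (∃! Q, WalshSpider.IsSemigroupOf (WalshSpider.formLaplacian N) Q) ∧
    ∀ P Q : ℝ≥0 → WalshSpider.SpiderL2 N →L[ℝ] WalshSpider.SpiderL2 N,
      WalshSpider.IsSemigroupOf (WalshSpider.laplacian N) P →
      WalshSpider.IsSemigroupOf (WalshSpider.formLaplacian N) Q →
      -- their explicit heat kernels
      (∀ t : ℝ≥0, 0 < t → WalshSpider.HasKernel (P t) (WalshSpider.heatKernel N t)) ∧
      (∀ t : ℝ≥0, 0 < t → WalshSpider.HasKernel (Q t) (WalshSpider.formHeatKernel N t)) ∧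
      -- the kernel bound, with its best constant
      (∀ t : ℝ, 0 < t → ∀ (j k : Fin N) (x y : ℝ), 0 ≤ x → 0 ≤ y →
        |WalshSpider.formHeatKernel N t j x k y|
          ≤ ((N : ℝ) - 1) * WalshSpider.heatKernel N t j x k y) ∧
      (∀ t : ℝ, 0 < t → ∀ C : ℝ,
        (∀ (j k : Fin N) (x y : ℝ), 0 < x → 0 < y →
          |WalshSpider.formHeatKernel N t j x k y| ≤ C * WalshSpider.heatKernel N t j x k y) →
        (N : ℝ) - 1 ≤ C) ∧
      -- the semigroup domination, with its best constant
      (∀ (t : ℝ≥0) (f : WalshSpider.SpiderL2 N),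
        WalshSpider.LeAE (WalshSpider.absL2 (Q t f))
          (((N : ℝ) - 1) • P t (WalshSpider.absL2 f))) ∧
      (∀ t : ℝ≥0, 0 < t → ∀ C : ℝ,
        (∀ f : WalshSpider.SpiderL2 N,
          WalshSpider.LeAE (WalshSpider.absL2 (Q t f)) (C • P t (WalshSpider.absL2 f))) →
        (N : ℝ) - 1 ≤ C) ∧
      -- the weak Bakry-Émery estimate, with its best constant
      (∀ (t : ℝ≥0), ∀ f ∈ WalshSpider.H10 N,
        P t f ∈ WalshSpider.H10 N ∧
        WalshSpider.LeAE (WalshSpider.sqrtCarre (P t f))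
          (((N : ℝ) - 1) • P t (WalshSpider.sqrtCarre f))) ∧
      (∀ t : ℝ≥0, 0 < t → ∀ C : ℝ,
        (∀ f ∈ WalshSpider.H10 N,
          WalshSpider.LeAE (WalshSpider.sqrtCarre (P t f))
            (C • P t (WalshSpider.sqrtCarre f))) →
        (N : ℝ) - 1 ≤ C) := by
  have hN0 : (N : ℝ) ≠ 0 := by positivity
  have hA : ∀ u v, (u, v) ∈ (WalshSpider.laplacian N).graph →
      WalshSpider.HasGenerator (WalshSpider.spiderHeat N 1) u v := fun u v h =>
    ((WalshSpider.mem_graph_laplacian hN0).1 h).hasGenerator (by norm_num)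
  have hB : ∀ u v, (u, v) ∈ (WalshSpider.formLaplacian N).graph →
      WalshSpider.HasGenerator (WalshSpider.spiderHeat N (-1)) u v := fun u v h =>
    ((WalshSpider.mem_graph_formLaplacian hN0).1 h).hasGenerator (by norm_num)
  have sA : ∀ f, ∃ u v, (u, v) ∈ (WalshSpider.laplacian N).graph ∧ u - v = f := by
    simpa only [WalshSpider.mem_graph_laplacian hN0] using
      WalshSpider.exists_hasSecondDeriv hN0 (ε := 1) (by norm_num)
  have sB : ∀ f, ∃ u v, (u, v) ∈ (WalshSpider.formLaplacian N).graph ∧ u - v = f := by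
    simpa only [WalshSpider.mem_graph_formLaplacian hN0] using
      WalshSpider.exists_hasSecondDeriv hN0 (ε := -1) (by norm_num)
  have cA := WalshSpider.isContractionSemigroup_spiderHeat (N := N) hN0 (ε := 1) (by norm_num)
  have cB := WalshSpider.isContractionSemigroup_spiderHeat (N := N) hN0 (ε := -1) (by norm_num)
  refine ⟨⟨_, cA.isSemigroupOf hA sA, fun S hS => cA.unique hA sA hS⟩,
    ⟨_, cB.isSemigroupOf hB sB, fun S hS => cB.unique hB sB hS⟩, ?_⟩
  intro P Q hP hQ
  obtain rfl := cA.unique hA sA hP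
  obtain rfl := cB.unique hB sB hQ
  refine ⟨fun t ht => ?_, fun t ht => ?_, fun t ht j k x y hx hy =>
    WalshSpider.abs_formHeatKernel_le hN ht j k hx hy, fun t ht C h => ?_,
    WalshSpider.leAE_spiderHeat hN, fun t ht C h => WalshSpider.sub_one_le_of_leAE hN ht h,
    fun t f hf => ?_, fun t ht C h => ?_⟩
  · rw [WalshSpider.heatKernel_eq]
    exact WalshSpider.hasKernel_spiderHeat ht
  · rw [WalshSpider.formHeatKernel_eq]
    exact WalshSpider.hasKernel_spiderHeat ht
  · set i : Fin N := ⟨0, by omega⟩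
    refine WalshSpider.sub_one_le_of_kernel_zero hN ht (i := i) ?_
    -- The hypothesis covers only points off the vertex, so the inequality at the vertex is the
    -- limit along the diagonal as `x` decreases to `0`.
    have hd : Continuous fun x : ℝ => (x, x) := by fun_prop
    have h1 := (WalshSpider.continuous_spiderKernel (-1) t i i).comp hd
    have h2 := ((WalshSpider.continuous_spiderKernel 1 t i i).comp hd).const_mul C
    refine le_of_tendsto_of_tendsto ((h1.tendsto 0).mono_left nhdsWithin_le_nhds)
      ((h2.tendsto 0).mono_left (nhdsWithin_le_nhds (s := Ioi 0))) ?_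
    filter_upwards [self_mem_nhdsWithin] with x hx
    have h3 := h i i x x hx hx
    rw [WalshSpider.heatKernel_eq, WalshSpider.formHeatKernel_eq] at h3
    exact (le_abs_self _).trans h3
  · obtain ⟨h1, h2⟩ := WalshSpider.deriv'_spiderHeat hN0 t hf
    refine ⟨h1, ?_⟩
    rw [WalshSpider.sqrtCarre_eq, WalshSpider.sqrtCarre_eq, h2]
    exact WalshSpider.leAE_spiderHeat hN t _
  · refine WalshSpider.sub_one_le_of_leAE hN ht fun g => ?_
    -- The estimate for `f` is the domination inequality at `f'`. The set of `g` satisfying that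
    -- inequality is closed and contains all `f'` with `f` in `H¹₀(X)`, which are dense, so the
    -- optimality for semigroup domination applies.
    have hcl := WalshSpider.isClosed_leAE (N := N)
      (WalshSpider.continuous_absL2.comp (WalshSpider.spiderHeat N (-1) t).continuous)
      (((WalshSpider.spiderHeat N 1 t).continuous.comp
        WalshSpider.continuous_absL2).const_smul C)
    refine hcl.closure_subset_iff.2 ?_ (WalshSpider.dense_deriv'_H10 g)
    rintro _ ⟨f, hf, rfl⟩
    have h1 := h f hf
    rw [WalshSpider.sqrtCarre_eq, WalshSpider.sqrtCarre_eq,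
      (WalshSpider.deriv'_spiderHeat hN0 t hf).2] at h1
    exact h1
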